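/- Let $P$ be a symmetric operad of sets. Let $F \dashv U$ be the adjunction between the forgetful functor $U$ from symmetric operads to sequences of sets $(\Phi_n)_{n\in\mathbb N}$ and the free symmetric operad functor $F$, with counit $\epsilon$. A *signature* for $P$ is a pair $(\Phi,\phi)$ where $\Phi$ is a sequence of sets and $\phi : F\Phi \to P$ is a regular epimorphism of symmetric operads. Regard symmetric operads of sets as symmetric $\mathbf{Cat}$-operads whose categories of $n$-ary operations are discrete. A *categorification* of $P$ with respect to $(\Phi,\phi)$ is a symmetric $\mathbf{Cat}$-operad $Q$ occurring in a factorization $$F\Phi \xrightarrow{\ b\ } Q \xrightarrow{\ f\ } P, \qquad f b = \phi,$$ in symmetric $\mathbf{Cat}$-operads, with $b$ levelwise bijective on objects and $f$ levelwise full and faithful (it exists and is unique up to isomorphism). Let $\mathrm{Wk}(P)$ be the categorification of $P$ with respect to the signature $(UP,\epsilon_P)$. For a symmetric $\mathbf{Cat}$-operad $Q$, a $Q$-algebra is a category $A$ with a morphism of symmetric $\mathbf{Cat}$-operads $Q \to \mathrm{End}(A)$, where $\mathrm{End}(A)_n$ is the category of functors $A^n \to A$; write $h_n : Q_n \times A^n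 \to A$ for the resulting functors. A *lax morphism* $(F,\xi) : (A,h) \to (B,h')$ is a functor $F : A \to B$ with natural transformations $\xi_n : h'_n\circ(1\times F^n) \to F\circ h_n$ such that $\xi$ at the unit of $Q$ is the identity, $\xi_{p\circ(q_1,\dots,q_n)}$ is the composite of $h'_n(1_p,\xi_{q_1},\dots,\xi_{q_n})$ followed by $\xi_p$, and $\xi_{\sigma\cdot p}$ at $(a_1,\dots,a_n)$ is $\xi_p$ at $(a_{\sigma(1)},\dots,a_{\sigma(n)})$. It is a *weak morphism* if all components of the $\xi_n$ are invertible. Let $\mathbf{Alg}_{\mathrm{wk}}(Q)$ be the category of $Q$-algebras and weak morphisms, and $\mathbf{Alg}_{\mathrm{lax}}(Q)$ that of $Q$-algebras and lax morphisms. Then for every signature $(\Phi,\phi)$ for $P$ and every categorification $Q$ of $P$ with respect to $(\Phi,\phi)$ there is an equivalence of categories $$\mathbf{Alg}_{\mathrm{wk}}(Q) \simeq \mathbf{Alg}_{\mathrm{wk}}(\mathrm{Wk}(P)),$$ and likewise, without requiring the $\xi_n$ to be invertible, $\mathbf{Alg}_{\mathrm{lax}}(Q) \simeq \mathbf{Alg}_{\mathrm{lax}}(\mathrm{Wk}(P))$.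 -/

import Mathlib

open CategoryTheory

universe v w u v₁ u₁ v₂ u₂ v₃ u₃

/-! ### Block decompositions of `Fin m` -/

/-- If `k₀ + ⋯ + k₍ₙ₋₁₎ = m`, the decomposition of `{0, …, m - 1}` into `n` consecutive blocks
of sizes `k i`: the pair `(i, j)` is the `j`-th element of the `i`-th block. -/
def blockEquiv {n m : ℕ} {k : Fin n → ℕ} (hm : ∑ i, k i = m) : (Σ i, Fin (k i)) ≃ Fin m :=
  finSigmaFinEquiv.trans (finCongr hm)

/-- The permutation of `m` letters which permutes blocks as `σ` does: it sends the `j`-th element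
of the `i`-th block in the decomposition into blocks of sizes `k (σ 0), k (σ 1), …` to the `j`-th
element of the `σ i`-th block in the decomposition into blocks of sizes `k 0, k 1, …`. -/
def blockPerm {n m : ℕ} {k : Fin n → ℕ} (σ : Equiv.Perm (Fin n)) (hm : ∑ i, k i = m)
    (hm' : ∑ i, k (σ i) = m) : Equiv.Perm (Fin m) :=
  (blockEquiv hm').symm.trans
    ((Equiv.sigmaCongrLeft (β := fun i => Fin (k i)) σ).trans (blockEquiv hm))

/-- The permutation of `m` letters which acts as `τ i` within the `i`-th block. -/
def blockSum {n m : ℕ} {k : Fin n → ℕ} (τ : ∀ i, Equiv.Perm (Fin (k i))) (hm : ∑ i, k i = m) :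
    Equiv.Perm (Fin m) :=
  (blockEquiv hm).symm.trans ((Equiv.sigmaCongrRight τ).trans (blockEquiv hm))

theorem blockEquiv_val {n m : ℕ} {k : Fin n → ℕ} (hm : ∑ i, k i = m) (i : Fin n) (j : Fin (k i)) :
    (blockEquiv hm ⟨i, j⟩ : ℕ) = (∑ i', if i' < i then k i' else 0) + j := by
  have h : (∑ i', if i' < i then k i' else 0) = ∑ i' : Fin i, k (Fin.castLE i.2.le i') := by
    rw [← Finset.sum_filter]
    symm
    refine Finset.sum_bij (fun a _ => Fin.castLE i.2.le a) ?_ ?_ ?_ ?_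
    · intro a _
      exact Finset.mem_filter.2 ⟨Finset.mem_univ _, a.2⟩
    · intro a _ b _ hab
      simpa using hab
    · intro b hb
      exact ⟨⟨b, (Finset.mem_filter.1 hb).2⟩, Finset.mem_univ _, rfl⟩
    · intro a _
      rfl
  rw [h]
  exact finSigmaFinEquiv_apply ⟨i, j⟩

theorem blockEquiv_lt {n m : ℕ} {k : Fin n → ℕ} (hm : ∑ i, k i = m) {i i' : Fin n} (hi : i' < i)
    (j : Fin (k i)) (j' : Fin (k i')) : blockEquiv hm ⟨i', j'⟩ < blockEquiv hm ⟨i, j⟩ := by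
  rw [Fin.lt_def, blockEquiv_val, blockEquiv_val]
  have h : (∑ x, if x < i' then k x else 0) + (∑ x, if x = i' then k x else 0)
      ≤ ∑ x, if x < i then k x else 0 := by
    rw [← Finset.sum_add_distrib]
    refine Finset.sum_le_sum fun x _ => ?_
    by_cases h1 : x < i'
    · simp [h1, h1.trans hi, h1.ne]
    · by_cases h2 : x = i'
      · subst h2
        simp [hi]
      · simp [h1, h2]
  have h' : (∑ x, if x = i' then k x else 0) = k i' := by simp
  have := j'.2
  omega

theorem blockEquiv_assoc {n p m : ℕ} {k : Fin n → ℕ} (hp : ∑ i, k i = p) {l : Fin p → ℕ}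
    {s : Fin n → ℕ} (hs : ∀ i, ∑ j, l (blockEquiv hp ⟨i, j⟩) = s i) (hm : ∑ i, s i = m)
    (hm' : ∑ r, l r = m) (i : Fin n) (j : Fin (k i)) (t : Fin (l (blockEquiv hp ⟨i, j⟩))) :
    blockEquiv hm ⟨i, blockEquiv (hs i) ⟨j, t⟩⟩ = blockEquiv hm' ⟨blockEquiv hp ⟨i, j⟩, t⟩ := by
  apply Fin.ext
  rw [blockEquiv_val, blockEquiv_val, blockEquiv_val, ← add_assoc]
  congr 1
  rw [← Equiv.sum_comp (blockEquiv hp), Fintype.sum_sigma]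
  have key : ∀ i', (∑ j', if blockEquiv hp ⟨i', j'⟩ < blockEquiv hp ⟨i, j⟩
      then l (blockEquiv hp ⟨i', j'⟩) else 0) = (if i' < i then s i' else 0) +
      (if i' = i then ∑ j', if j' < j then l (blockEquiv hp ⟨i, j'⟩) else 0 else 0) := by
    intro i'
    rcases lt_trichotomy i' i with h | h | h
    · simp only [blockEquiv_lt hp h, if_true, hs, h, h.ne, if_false, add_zero]
    · subst h
      have : ∀ j', blockEquiv hp ⟨i', j'⟩ < blockEquiv hp ⟨i', j⟩ ↔ j' < j := by
        intro j'
        rw [Fin.lt_def, blockEquiv_val, blockEquiv_val, Fin.lt_def]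
        omega
      simp [this]
    · have h' : ∀ j', ¬ blockEquiv hp ⟨i', j'⟩ < blockEquiv hp ⟨i, j⟩ := fun j' =>
        (blockEquiv_lt hp h j' j).not_gt
      simp [h', h.ne', h.not_gt]
  simp only [key, Finset.sum_add_distrib]
  simp

theorem blockEquiv_one_left {n : ℕ} (hm : ∑ _i : Fin 1, n = n) (i : Fin 1) (j : Fin n) :
    blockEquiv (k := fun _ => n) hm ⟨i, j⟩ = j := by
  apply Fin.ext
  rw [blockEquiv_val]
  simp [Subsingleton.elim i 0]

theorem blockEquiv_one_right {n : ℕ} (hm : ∑ _i : Fin n, 1 = n) (i : Fin n) (j : Fin 1) :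
    blockEquiv (k := fun _ => 1) hm ⟨i, j⟩ = i := by
  apply Fin.ext
  rw [blockEquiv_val, ← Finset.sum_filter, Finset.sum_const, smul_eq_mul, mul_one]
  have : (Finset.univ.filter fun x : Fin n => x < i) = Finset.Iio i := by
    ext x
    simp
  rw [this, Fin.card_Iio]
  omega

theorem blockPerm_apply {n m : ℕ} {k : Fin n → ℕ} (σ : Equiv.Perm (Fin n)) (hm : ∑ i, k i = m)
    (hm' : ∑ i, k (σ i) = m) (i : Fin n) (j : Fin (k (σ i))) :
    blockPerm σ hm hm' (blockEquiv (k := fun i => k (σ i)) hm' ⟨i, j⟩) =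
      blockEquiv hm ⟨σ i, j⟩ := by
  simp [blockPerm, Equiv.sigmaCongrLeft]

theorem blockSum_apply {n m : ℕ} {k : Fin n → ℕ} (τ : ∀ i, Equiv.Perm (Fin (k i)))
    (hm : ∑ i, k i = m) (i : Fin n) (j : Fin (k i)) :
    blockSum τ hm (blockEquiv hm ⟨i, j⟩) = blockEquiv hm ⟨i, τ i j⟩ := by
  simp [blockSum]

/-! ### Symmetric operads of sets -/

/-- A symmetric operad (of sets). Composition `P n × P (k 0) × ⋯ × P (k (n - 1)) → P (∑ i, k i)`
is recorded as an operation into `P m` for every `m` that is equal to `∑ i, k i`. -/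
structure SymOperad where
  op : ℕ → Type u
  one : op 1
  comp : ∀ {n m : ℕ} {k : Fin n → ℕ}, ∑ i, k i = m → op n → (∀ i, op (k i)) → op m
  act : ∀ {n : ℕ}, Equiv.Perm (Fin n) → op n → op n
  assoc : ∀ {n p m : ℕ} {k : Fin n → ℕ} (hp : ∑ i, k i = p) {l : Fin p → ℕ} {s : Fin n → ℕ}
    (hs : ∀ i, ∑ j, l (blockEquiv hp ⟨i, j⟩) = s i) (hm : ∑ i, s i = m) (hm' : ∑ r, l r = m)
    (f : op n) (g : ∀ i, op (k i)) (h : ∀ r, op (l r)),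
    comp hm f (fun i => comp (hs i) (g i) (fun j => h (blockEquiv hp ⟨i, j⟩))) =
      comp hm' (comp hp f g) h
  one_comp : ∀ {n : ℕ} (hm : ∑ _i : Fin 1, n = n) (f : op n), comp hm one (fun _ => f) = f
  comp_one : ∀ {n : ℕ} (hm : ∑ _i : Fin n, 1 = n) (f : op n), comp hm f (fun _ => one) = f
  act_one : ∀ {n : ℕ} (f : op n), act 1 f = f
  act_mul : ∀ {n : ℕ} (σ τ : Equiv.Perm (Fin n)) (f : op n), act (σ * τ) f = act σ (act τ f)
  act_comp : ∀ {n m : ℕ} {k : Fin n → ℕ} (σ : Equiv.Perm (Fin n)) (hm : ∑ i, k i = m)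
    (hm' : ∑ i, k (σ i) = m) (f : op n) (g : ∀ i, op (k i)),
    comp hm (act σ f) g = act (blockPerm σ hm hm') (comp hm' f (fun i => g (σ i)))
  comp_act : ∀ {n m : ℕ} {k : Fin n → ℕ} (τ : ∀ i, Equiv.Perm (Fin (k i))) (hm : ∑ i, k i = m)
    (f : op n) (g : ∀ i, op (k i)),
    comp hm f (fun i => act (τ i) (g i)) = act (blockSum τ hm) (comp hm f g)

namespace SymOperad

/-- A morphism of symmetric operads. -/
@[ext]
structure Hom (P : SymOperad.{u}) (P' : SymOperad.{u}) where
  map : ∀ {n : ℕ}, P.op n → P'.op n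
  map_one : map P.one = P'.one
  map_comp : ∀ {n m : ℕ} {k : Fin n → ℕ} (hm : ∑ i, k i = m) (f : P.op n) (g : ∀ i, P.op (k i)),
    map (P.comp hm f g) = P'.comp hm (map f) (fun i => map (g i))
  map_act : ∀ {n : ℕ} (σ : Equiv.Perm (Fin n)) (f : P.op n), map (P.act σ f) = P'.act σ (map f)

/-- The category of symmetric operads. -/
instance : Category SymOperad.{u} where
  Hom := Hom
  id P := ⟨fun f => f, rfl, fun _ _ _ => rfl, fun _ _ => rfl⟩
  comp F G := ⟨fun f => G.map (F.map f), by rw [F.map_one, G.map_one],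
    fun hm f g => by rw [F.map_comp, G.map_comp], fun σ f => by rw [F.map_act, G.map_act]⟩

@[simp]
theorem id_map (P : SymOperad.{u}) {n : ℕ} (f : P.op n) : Hom.map (𝟙 P) f = f := rfl

@[simp]
theorem comp_map {P P' P'' : SymOperad.{u}} (F : P ⟶ P') (G : P' ⟶ P'') {n : ℕ} (f : P.op n) :
    Hom.map (F ≫ G) f = G.map (F.map f) := rfl

@[ext]
theorem hom_ext {P P' : SymOperad.{u}} {F G : P ⟶ P'}
    (h : ∀ (n : ℕ) (f : P.op n), F.map f = G.map f) : F = G := by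
  apply Hom.ext
  funext n f
  exact h n f

/-! ### The free symmetric operad on a sequence of sets -/

/-- Formal operadic expressions in the generators `Φ`. -/
inductive Term (Φ : ℕ → Type u) : ℕ → Type u
  | gen {n : ℕ} (x : Φ n) : Term Φ n
  | one : Term Φ 1
  | comp {n m : ℕ} {k : Fin n → ℕ} (hm : ∑ i, k i = m) (f : Term Φ n) (g : ∀ i, Term Φ (k i)) :
      Term Φ m
  | act {n : ℕ} (σ : Equiv.Perm (Fin n)) (f : Term Φ n) : Term Φ n

/-- The congruence on formal expressions generated by the axioms of symmetric operads. -/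
inductive Term.Rel (Φ : ℕ → Type u) : ∀ {n : ℕ}, Term Φ n → Term Φ n → Prop
  | refl {n : ℕ} (f : Term Φ n) : Term.Rel Φ f f
  | symm {n : ℕ} {f g : Term Φ n} : Term.Rel Φ f g → Term.Rel Φ g f
  | trans {n : ℕ} {f g h : Term Φ n} : Term.Rel Φ f g → Term.Rel Φ g h → Term.Rel Φ f h
  | congr_comp {n m : ℕ} {k : Fin n → ℕ} (hm : ∑ i, k i = m) {f f' : Term Φ n}
      {g g' : ∀ i, Term Φ (k i)} : Term.Rel Φ f f' → (∀ i, Term.Rel Φ (g i) (g' i)) →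
      Term.Rel Φ (.comp hm f g) (.comp hm f' g')
  | congr_act {n : ℕ} (σ : Equiv.Perm (Fin n)) {f f' : Term Φ n} :
      Term.Rel Φ f f' → Term.Rel Φ (.act σ f) (.act σ f')
  | assoc {n p m : ℕ} {k : Fin n → ℕ} (hp : ∑ i, k i = p) {l : Fin p → ℕ} {s : Fin n → ℕ}
      (hs : ∀ i, ∑ j, l (blockEquiv hp ⟨i, j⟩) = s i) (hm : ∑ i, s i = m) (hm' : ∑ r, l r = m)
      (f : Term Φ n) (g : ∀ i, Term Φ (k i)) (h : ∀ r, Term Φ (l r)) :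
      Term.Rel Φ
        (.comp hm f (fun i => .comp (hs i) (g i) (fun j => h (blockEquiv hp ⟨i, j⟩))))
        (.comp hm' (.comp hp f g) h)
  | one_comp {n : ℕ} (hm : ∑ _i : Fin 1, n = n) (f : Term Φ n) :
      Term.Rel Φ (.comp hm .one (fun _ => f)) f
  | comp_one {n : ℕ} (hm : ∑ _i : Fin n, 1 = n) (f : Term Φ n) :
      Term.Rel Φ (.comp hm f (fun _ => .one)) f
  | act_one {n : ℕ} (f : Term Φ n) : Term.Rel Φ (.act 1 f) f
  | act_mul {n : ℕ} (σ τ : Equiv.Perm (Fin n)) (f : Term Φ n) :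
      Term.Rel Φ (.act (σ * τ) f) (.act σ (.act τ f))
  | act_comp {n m : ℕ} {k : Fin n → ℕ} (σ : Equiv.Perm (Fin n)) (hm : ∑ i, k i = m)
      (hm' : ∑ i, k (σ i) = m) (f : Term Φ n) (g : ∀ i, Term Φ (k i)) :
      Term.Rel Φ (.comp hm (.act σ f) g)
        (.act (blockPerm σ hm hm') (.comp hm' f (fun i => g (σ i))))
  | comp_act {n m : ℕ} {k : Fin n → ℕ} (τ : ∀ i, Equiv.Perm (Fin (k i))) (hm : ∑ i, k i = m)
      (f : Term Φ n) (g : ∀ i, Term Φ (k i)) :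
      Term.Rel Φ (.comp hm f (fun i => .act (τ i) (g i)))
        (.act (blockSum τ hm) (.comp hm f g))

/-- Formal expressions up to the axioms of symmetric operads. -/
def Term.setoid (Φ : ℕ → Type u) (n : ℕ) : Setoid (Term Φ n) where
  r := Term.Rel Φ
  iseqv := ⟨.refl, .symm, .trans⟩

theorem Term.rel_out {Φ : ℕ → Type u} {n : ℕ} (f : Term Φ n) :
    Term.Rel Φ (Quotient.mk (Term.setoid Φ n) f).out f :=
  Quotient.exact (s := Term.setoid Φ n) (Quotient.out_eq _)

theorem Term.sound {Φ : ℕ → Type u} {n : ℕ} {f g : Term Φ n} (h : Term.Rel Φ f g) :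
    Quotient.mk (Term.setoid Φ n) f = Quotient.mk (Term.setoid Φ n) g :=
  Quotient.sound (s := Term.setoid Φ n) h

/-- The free symmetric operad on the sequence of sets `Φ`: formal expressions in the generators,
modulo the axioms of symmetric operads. -/
noncomputable def free (Φ : ℕ → Type u) : SymOperad.{u} where
  op n := Quotient (Term.setoid Φ n)
  one := Quotient.mk _ .one
  comp hm f g := Quotient.mk _ (.comp hm f.out (fun i => (g i).out))
  act σ f := Quotient.mk _ (.act σ f.out)
  assoc hp _ _ hs hm hm' f g h := Term.sound <|
    .trans (.congr_comp hm (.refl _) fun _ => Term.rel_out _) <|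
    .trans (.assoc hp hs hm hm' f.out (fun i => (g i).out) (fun r => (h r).out)) <|
    .symm (.congr_comp hm' (Term.rel_out _) fun _ => .refl _)
  one_comp hm f := (Term.sound <|
    .trans (.congr_comp hm (Term.rel_out _) fun _ => .refl _) (.one_comp hm f.out)).trans
      (Quotient.out_eq _)
  comp_one hm f := (Term.sound <|
    .trans (.congr_comp hm (.refl _) fun _ => Term.rel_out _) (.comp_one hm f.out)).trans
      (Quotient.out_eq _)
  act_one f := (Term.sound (.act_one f.out)).trans (Quotient.out_eq _)
  act_mul σ τ f := Term.sound <|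
    .trans (.act_mul σ τ f.out) (.symm (.congr_act σ (Term.rel_out _)))
  act_comp σ hm hm' f g := Term.sound <|
    .trans (.congr_comp hm (Term.rel_out _) fun _ => .refl _) <|
    .trans (.act_comp σ hm hm' f.out (fun i => (g i).out)) <|
    .symm (.congr_act _ (Term.rel_out _))
  comp_act τ hm f g := Term.sound <|
    .trans (.congr_comp hm (.refl _) fun _ => Term.rel_out _) <|
    .trans (.comp_act τ hm f.out (fun i => (g i).out)) <|
    .symm (.congr_act _ (Term.rel_out _))

/-- The operation given by a formal expression. -/
def free.mk {Φ : ℕ → Type u} {n : ℕ} (f : Term Φ n) : (free Φ).op n :=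
  Quotient.mk (Term.setoid Φ n) f

/-- The inclusion of generators. -/
def free.gen {Φ : ℕ → Type u} {n : ℕ} (x : Φ n) : (free Φ).op n :=
  free.mk (.gen x)

theorem free.mk_comp {Φ : ℕ → Type u} {n m : ℕ} {k : Fin n → ℕ} (hm : ∑ i, k i = m)
    (f : Term Φ n) (g : ∀ i, Term Φ (k i)) :
    free.mk (.comp hm f g) = (free Φ).comp hm (free.mk f) (fun i => free.mk (g i)) :=
  Term.sound (.symm (.congr_comp hm (Term.rel_out _) fun _ => Term.rel_out _))

theorem free.mk_act {Φ : ℕ → Type u} {n : ℕ} (σ : Equiv.Perm (Fin n)) (f : Term Φ n) :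
    free.mk (.act σ f) = (free Φ).act σ (free.mk f) :=
  Term.sound (.symm (.congr_act σ (Term.rel_out _)))

theorem free.exists_mk {Φ : ℕ → Type u} {n : ℕ} (f : (free Φ).op n) : ∃ t, free.mk t = f :=
  Quotient.exists_rep f

/-- The value of a formal expression in an operad, given values of the generators. -/
def Term.eval {Φ : ℕ → Type u} (P : SymOperad.{u}) (x : ∀ n, Φ n → P.op n) :
    ∀ {n : ℕ}, Term Φ n → P.op n
  | _, .gen y => x _ y
  | _, .one => P.one
  | _, .comp hm f g => P.comp hm (f.eval P x) (fun i => (g i).eval P x)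
  | _, .act σ f => P.act σ (f.eval P x)

theorem Term.eval_rel {Φ : ℕ → Type u} (P : SymOperad.{u}) (x : ∀ n, Φ n → P.op n) {n : ℕ}
    {f g : Term Φ n} (h : Term.Rel Φ f g) : f.eval P x = g.eval P x := by
  induction h with
  | refl => rfl
  | symm _ ih => exact ih.symm
  | trans _ _ ih ih' => exact ih.trans ih'
  | congr_comp hm _ _ ih ih' => simp only [Term.eval, ih, ih']
  | congr_act σ _ ih => simp only [Term.eval, ih]
  | assoc hp hs hm hm' f g h => exact P.assoc hp hs hm hm' _ _ (fun r => (h r).eval P x)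
  | one_comp hm f => exact P.one_comp hm _
  | comp_one hm f => exact P.comp_one hm _
  | act_one f => exact P.act_one _
  | act_mul σ τ f => exact P.act_mul σ τ _
  | act_comp σ hm hm' f g => exact P.act_comp σ hm hm' _ (fun i => (g i).eval P x)
  | comp_act τ hm f g => exact P.comp_act τ hm _ _

/-- The morphism out of a free symmetric operad with given values on generators. -/
def free.lift {Φ : ℕ → Type u} {P : SymOperad.{u}} (x : ∀ n, Φ n → P.op n) : free Φ ⟶ P where
  map {n} := Quotient.lift (Term.eval P x) fun _ _ h => Term.eval_rel P x h
  map_one := rfl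
  map_comp {n m k} hm f g := by
    have h : ∀ {n : ℕ} (f : (free Φ).op n),
        Quotient.lift (Term.eval P x) (fun _ _ h => Term.eval_rel P x h) f =
          Term.eval P x f.out := by
      intro n f
      conv_lhs => rw [← Quotient.out_eq f]
      rfl
    rw [h f]
    simp only [h (g _)]
    rfl
  map_act {n} σ f := by
    conv_rhs => rw [← Quotient.out_eq f]
    rfl

theorem free.hom_ext {Φ : ℕ → Type u} {P : SymOperad.{u}} {F G : free Φ ⟶ P}
    (h : ∀ (n : ℕ) (x : Φ n), F.map (free.gen x) = G.map (free.gen x)) : F = G := by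
  ext _ f
  obtain ⟨t, rfl⟩ := free.exists_mk f
  induction t with
  | gen x => exact h _ x
  | one => exact F.map_one.trans G.map_one.symm
  | comp hm f g ih ih' =>
    rw [free.mk_comp, F.map_comp, G.map_comp, ih]
    simp only [ih']
  | act σ f ih => rw [free.mk_act, F.map_act, G.map_act, ih]

/-- The free symmetric operad is left adjoint to the forgetful functor to sequences of sets:
morphisms `free Φ ⟶ P` correspond to sequences of maps `Φ n → P n`. -/
def freeHomEquiv (Φ : ℕ → Type u) (P : SymOperad.{u}) :
    (free Φ ⟶ P) ≃ (∀ n, Φ n → P.op n) where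
  toFun F n x := F.map (free.gen x)
  invFun x := free.lift x
  left_inv _ := free.hom_ext fun _ _ => rfl
  right_inv _ := rfl

/-- The counit `ε : F U P ⟶ P`, which is the identity on generators. -/
def counit (P : SymOperad.{u}) : free P.op ⟶ P :=
  (freeHomEquiv P.op P).symm fun _ f => f

/-! ### Signatures -/

/-- A signature for `P`: a sequence of sets `Φ` with a regular epimorphism `φ : F Φ ⟶ P` in the
category of symmetric operads. -/
structure Signature (P : SymOperad.{u}) where
  Φ : ℕ → Type u
  φ : free Φ ⟶ P
  regularEpi : IsRegularEpi φ

theorem isRegularEpi_counit (P : SymOperad.{u}) : IsRegularEpi (counit P) := by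
  have e : ∀ {n : ℕ} (f : P.op n), (counit P).map (free.gen f) = f := fun f => rfl
  let left : free (free P.op).op ⟶ free P.op := counit (free P.op)
  let right : free (free P.op).op ⟶ free P.op := free.lift fun n f => free.gen ((counit P).map f)
  have el : ∀ {n : ℕ} (f : (free P.op).op n), left.map (free.gen f) = f := fun f => rfl
  have er : ∀ {n : ℕ} (f : (free P.op).op n),
      right.map (free.gen f) = free.gen ((counit P).map f) := fun f => rfl
  have w : left ≫ counit P = right ≫ counit P := by
    refine free.hom_ext fun n f => ?_
    rw [comp_map, comp_map, el, er, e]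
  have key : ∀ {W : SymOperad.{u}} (h : free P.op ⟶ W), left ≫ h = right ≫ h →
      ∀ (n : ℕ) (x : (free P.op).op n), h.map x = h.map (free.gen ((counit P).map x)) := by
    intro W h hh n x
    have := congrArg (fun F : free (free P.op).op ⟶ W => F.map (free.gen x)) hh
    simpa only [comp_map, el, er] using this
  refine ⟨⟨⟨_, left, right, w, Limits.Cofork.IsColimit.mk' _ fun s => ?_⟩⟩⟩
  have hs := key s.π s.condition
  refine ⟨⟨fun f => s.π.map (free.gen f), ?_, ?_, ?_⟩, ?_, ?_⟩
  · exact (hs _ (free P.op).one).symm.trans s.π.map_one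
  · intro n m k hm f g
    rw [← s.π.map_comp, hs _ ((free P.op).comp hm _ _), (counit P).map_comp]
    rfl
  · intro n σ f
    rw [← s.π.map_act, hs _ ((free P.op).act σ _), (counit P).map_act]
    rfl
  · ext n x
    exact (hs n x).symm
  · intro m hm
    ext n f
    exact congrArg (fun F : free P.op ⟶ s.pt => F.map (free.gen f)) hm

/-- The signature `(U P, ε)` for `P`. -/
def unbiasedSignature (P : SymOperad.{u}) : Signature P where
  Φ := P.op
  φ := counit P
  regularEpi := isRegularEpi_counit P

end SymOperad

/-! ### Symmetric operads of categories -/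

set_option linter.checkUnivs false in
/-- A symmetric **Cat**-operad. Each axiom is an equality of functors, stated by its components
on objects and on morphisms. -/
structure CatOperad where
  op : ℕ → Type u
  [cat : ∀ n, Category.{v} (op n)]
  one : op 1
  comp : ∀ {n m : ℕ} {k : Fin n → ℕ}, ∑ i, k i = m → (op n × ∀ i, op (k i)) ⥤ op m
  act : ∀ {n : ℕ}, Equiv.Perm (Fin n) → op n ⥤ op n
  assoc_obj : ∀ {n p m : ℕ} {k : Fin n → ℕ} (hp : ∑ i, k i = p) {l : Fin p → ℕ} {s : Fin n → ℕ}
    (hs : ∀ i, ∑ j, l (blockEquiv hp ⟨i, j⟩) = s i) (hm : ∑ i, s i = m) (hm' : ∑ r, l r = m)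
    (f : op n) (g : ∀ i, op (k i)) (h : ∀ r, op (l r)),
    (comp hm).obj (f, fun i => (comp (hs i)).obj (g i, fun j => h (blockEquiv hp ⟨i, j⟩))) =
      (comp hm').obj ((comp hp).obj (f, g), h)
  assoc_map : ∀ {n p m : ℕ} {k : Fin n → ℕ} (hp : ∑ i, k i = p) {l : Fin p → ℕ} {s : Fin n → ℕ}
    (hs : ∀ i, ∑ j, l (blockEquiv hp ⟨i, j⟩) = s i) (hm : ∑ i, s i = m) (hm' : ∑ r, l r = m)
    {f f' : op n} {g g' : ∀ i, op (k i)} {h h' : ∀ r, op (l r)}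
    (α : f ⟶ f') (β : ∀ i, g i ⟶ g' i) (γ : ∀ r, h r ⟶ h' r),
    HEq
      ((comp hm).map (Prod.mkHom α (Y₁ := fun i => (comp (hs i)).obj _)
        (Y₂ := fun i => (comp (hs i)).obj _)
        fun i => (comp (hs i)).map (Prod.mkHom (β i)
          (Y₁ := fun j => h (blockEquiv hp ⟨i, j⟩)) (Y₂ := fun j => h' (blockEquiv hp ⟨i, j⟩))
          fun j => γ (blockEquiv hp ⟨i, j⟩))))
      ((comp hm').map (Prod.mkHom ((comp hp).map (Prod.mkHom α β)) γ))
  one_comp_obj : ∀ {n : ℕ} (hm : ∑ _i : Fin 1, n = n) (f : op n),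
    (comp hm).obj (one, fun _ => f) = f
  one_comp_map : ∀ {n : ℕ} (hm : ∑ _i : Fin 1, n = n) {f f' : op n} (α : f ⟶ f'),
    HEq ((comp hm).map (Prod.mkHom (𝟙 one) (Y₁ := fun _ => f) (Y₂ := fun _ => f') fun _ => α)) α
  comp_one_obj : ∀ {n : ℕ} (hm : ∑ _i : Fin n, 1 = n) (f : op n),
    (comp hm).obj (f, fun _ => one) = f
  comp_one_map : ∀ {n : ℕ} (hm : ∑ _i : Fin n, 1 = n) {f f' : op n} (α : f ⟶ f'),
    HEq ((comp hm).map
      (Prod.mkHom α (Y₁ := fun _ => one) (Y₂ := fun _ => one) fun _ => 𝟙 one)) α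
  act_one : ∀ {n : ℕ}, act (1 : Equiv.Perm (Fin n)) = 𝟭 (op n)
  act_mul : ∀ {n : ℕ} (σ τ : Equiv.Perm (Fin n)), act (σ * τ) = act τ ⋙ act σ
  act_comp_obj : ∀ {n m : ℕ} {k : Fin n → ℕ} (σ : Equiv.Perm (Fin n)) (hm : ∑ i, k i = m)
    (hm' : ∑ i, k (σ i) = m) (f : op n) (g : ∀ i, op (k i)),
    (comp hm).obj ((act σ).obj f, g) =
      (act (blockPerm σ hm hm')).obj ((comp hm').obj (f, fun i => g (σ i)))
  act_comp_map : ∀ {n m : ℕ} {k : Fin n → ℕ} (σ : Equiv.Perm (Fin n)) (hm : ∑ i, k i = m)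
    (hm' : ∑ i, k (σ i) = m) {f f' : op n} {g g' : ∀ i, op (k i)}
    (α : f ⟶ f') (β : ∀ i, g i ⟶ g' i),
    HEq ((comp hm).map (Prod.mkHom ((act σ).map α) β))
      ((act (blockPerm σ hm hm')).map ((comp hm').map
        (Prod.mkHom α (Y₁ := fun i => g (σ i)) (Y₂ := fun i => g' (σ i)) fun i => β (σ i))))
  comp_act_obj : ∀ {n m : ℕ} {k : Fin n → ℕ} (τ : ∀ i, Equiv.Perm (Fin (k i)))
    (hm : ∑ i, k i = m) (f : op n) (g : ∀ i, op (k i)),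
    (comp hm).obj (f, fun i => (act (τ i)).obj (g i)) =
      (act (blockSum τ hm)).obj ((comp hm).obj (f, g))
  comp_act_map : ∀ {n m : ℕ} {k : Fin n → ℕ} (τ : ∀ i, Equiv.Perm (Fin (k i)))
    (hm : ∑ i, k i = m) {f f' : op n} {g g' : ∀ i, op (k i)}
    (α : f ⟶ f') (β : ∀ i, g i ⟶ g' i),
    HEq ((comp hm).map (Prod.mkHom α (Y₁ := fun i => (act (τ i)).obj (g i))
        (Y₂ := fun i => (act (τ i)).obj (g' i)) fun i => (act (τ i)).map (β i)))
      ((act (blockSum τ hm)).map ((comp hm).map (Prod.mkHom α β)))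

attribute [instance] CatOperad.cat

namespace CatOperad

/-- A morphism of symmetric **Cat**-operads. -/
structure Hom (Q : CatOperad.{v₁, u₁}) (R : CatOperad.{v₂, u₂}) where
  map : ∀ n : ℕ, Q.op n ⥤ R.op n
  map_one : (map 1).obj Q.one = R.one
  map_comp : ∀ {n m : ℕ} {k : Fin n → ℕ} (hm : ∑ i, k i = m),
    Q.comp hm ⋙ map m = ((map n).prod (Functor.pi fun i => map (k i))) ⋙ R.comp hm
  map_act : ∀ {n : ℕ} (σ : Equiv.Perm (Fin n)), Q.act σ ⋙ map n = map n ⋙ R.act σ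


theorem heq_of_thin {C : Type u} [Category.{v} C] [Quiver.IsThin C] {a b c d : C} (h : a = c)
    (h' : b = d) (f : a ⟶ b) (g : c ⟶ d) : HEq f g := by
  subst h h'
  exact heq_of_eq (Subsingleton.elim f g)

theorem thin_elim {C : Type u} [Category.{v} C] [Quiver.IsThin C] {a b : C} (f g : a ⟶ b) :
    f = g := Subsingleton.elim f g

/-- A symmetric operad of sets, regarded as a symmetric **Cat**-operad with only identity
arrows. -/
def discrete (P : SymOperad.{u}) : CatOperad.{u, u} where
  op n := Discrete (P.op n)
  one := ⟨P.one⟩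
  comp hm :=
    { obj := fun x => ⟨P.comp hm x.1.as fun i => (x.2 i).as⟩
      map := fun {x y} α => Discrete.eqToHom (by
        have h : ∀ i, (x.2 i).as = (y.2 i).as := fun i => Discrete.eq_of_hom (α.2 i)
        simp only [Discrete.eq_of_hom α.1, h])
      map_id := fun _ => Subsingleton.elim _ _
      map_comp := fun _ _ => Subsingleton.elim _ _ }
  act σ :=
    { obj := fun x => ⟨P.act σ x.as⟩
      map := fun α => Discrete.eqToHom (congrArg (P.act σ) (Discrete.eq_of_hom α))
      map_id := fun _ => Subsingleton.elim _ _
      map_comp := fun _ _ => Subsingleton.elim _ _ }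
  assoc_obj hp _ _ hs hm hm' f g h := congrArg Discrete.mk
    (P.assoc hp hs hm hm' f.as (fun i => (g i).as) (fun r => (h r).as))
  assoc_map hp _ _ hs hm hm' f f' g g' h h' _ _ _ := heq_of_thin
    (congrArg Discrete.mk (P.assoc hp hs hm hm' f.as (fun i => (g i).as) (fun r => (h r).as)))
    (congrArg Discrete.mk (P.assoc hp hs hm hm' f'.as (fun i => (g' i).as) (fun r => (h' r).as)))
    _ _
  one_comp_obj hm f := congrArg Discrete.mk (P.one_comp hm f.as)
  one_comp_map hm f f' _ := heq_of_thin (congrArg Discrete.mk (P.one_comp hm f.as))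
    (congrArg Discrete.mk (P.one_comp hm f'.as)) _ _
  comp_one_obj hm f := congrArg Discrete.mk (P.comp_one hm f.as)
  comp_one_map hm f f' _ := heq_of_thin (congrArg Discrete.mk (P.comp_one hm f.as))
    (congrArg Discrete.mk (P.comp_one hm f'.as)) _ _
  act_one := Functor.hext (fun f => congrArg Discrete.mk (P.act_one f.as)) fun f f' _ =>
    heq_of_thin (congrArg Discrete.mk (P.act_one f.as))
      (congrArg Discrete.mk (P.act_one f'.as)) _ _
  act_mul σ τ := Functor.hext (fun f => congrArg Discrete.mk (P.act_mul σ τ f.as)) fun f f' _ =>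
    heq_of_thin (congrArg Discrete.mk (P.act_mul σ τ f.as))
      (congrArg Discrete.mk (P.act_mul σ τ f'.as)) _ _
  act_comp_obj σ hm hm' f g := congrArg Discrete.mk
    (P.act_comp σ hm hm' f.as (fun i => (g i).as))
  act_comp_map σ hm hm' f f' g g' _ _ := heq_of_thin
    (congrArg Discrete.mk (P.act_comp σ hm hm' f.as (fun i => (g i).as)))
    (congrArg Discrete.mk (P.act_comp σ hm hm' f'.as (fun i => (g' i).as))) _ _
  comp_act_obj τ hm f g := congrArg Discrete.mk (P.comp_act τ hm f.as (fun i => (g i).as))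
  comp_act_map τ hm f f' g g' _ _ := heq_of_thin
    (congrArg Discrete.mk (P.comp_act τ hm f.as (fun i => (g i).as)))
    (congrArg Discrete.mk (P.comp_act τ hm f'.as (fun i => (g' i).as))) _ _

instance (P : SymOperad.{u}) (n : ℕ) : Quiver.IsThin ((discrete P).op n) :=
  fun _ _ => inferInstanceAs (Subsingleton (ULift (PLift _)))

/-- The morphism of discrete symmetric **Cat**-operads given by a morphism of symmetric operads. -/
def discreteMap {P P' : SymOperad.{u}} (φ : P ⟶ P') : Hom (discrete P) (discrete P') where
  map n :=
    { obj := fun x => ⟨φ.map x.as⟩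
      map := fun α => Discrete.eqToHom (congrArg φ.map (Discrete.eq_of_hom α))
      map_id := fun _ => thin_elim _ _
      map_comp := fun _ _ => thin_elim _ _ }
  map_one := congrArg Discrete.mk φ.map_one
  map_comp hm := Functor.hext
    (fun x => congrArg Discrete.mk (φ.map_comp hm x.1.as fun i => (x.2 i).as))
    fun x y _ => heq_of_thin (congrArg Discrete.mk (φ.map_comp hm x.1.as fun i => (x.2 i).as))
      (congrArg Discrete.mk (φ.map_comp hm y.1.as fun i => (y.2 i).as)) _ _
  map_act σ := Functor.hext (fun x => congrArg Discrete.mk (φ.map_act σ x.as))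
    fun x y _ => heq_of_thin (congrArg Discrete.mk (φ.map_act σ x.as))
      (congrArg Discrete.mk (φ.map_act σ y.as)) _ _

end CatOperad

namespace SymOperad

open CatOperad

/-- A categorification of `P` with respect to the signature `S = (Φ, φ)`: a symmetric
**Cat**-operad `Q` with a factorization of `φ : F Φ ⟶ P` (a morphism of discrete symmetric
**Cat**-operads) into `b : F Φ ⟶ Q`, bijective on objects, followed by `f : Q ⟶ P`, levelwise full
and faithful. -/
structure Categorification {P : SymOperad.{u}} (S : Signature P) where
  Q : CatOperad.{u, u}
  b : CatOperad.Hom (discrete (free S.Φ)) Q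
  f : CatOperad.Hom Q (discrete P)
  fac : ∀ n, b.map n ⋙ f.map n = (discreteMap S.φ).map n
  bijective : ∀ n, Function.Bijective (b.map n).obj
  full : ∀ n, (f.map n).Full
  faithful : ∀ n, (f.map n).Faithful

/-- Objects of arity `n`: those of `X`. There is exactly one arrow from `x` to `y` if
`φ x = φ y`, and none otherwise. -/
abbrev KernelCat {X P : SymOperad.{u}} (φ : X ⟶ P) (n : ℕ) : Type u :=
  InducedCategory (Discrete (P.op n)) (fun x : X.op n => Discrete.mk (φ.map x))

instance {X P : SymOperad.{u}} (φ : X ⟶ P) (n : ℕ) : Quiver.IsThin (KernelCat φ n) :=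
  fun _ _ => ⟨fun _ _ => InducedCategory.hom_ext (Subsingleton.elim _ _)⟩

theorem KernelCat.eq_of_hom {X P : SymOperad.{u}} {φ : X ⟶ P} {n : ℕ} {x y : KernelCat φ n}
    (α : x ⟶ y) : φ.map (n := n) x = φ.map (n := n) y :=
  Discrete.eq_of_hom α.hom

/-- The arrow of `KernelCat φ n` from `x` to `y` when `φ x = φ y`. -/
def KernelCat.homMk {X P : SymOperad.{u}} {φ : X ⟶ P} {n : ℕ} {x y : KernelCat φ n}
    (h : φ.map (n := n) x = φ.map (n := n) y) : x ⟶ y :=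
  InducedCategory.homMk (Discrete.eqToHom h)

theorem KernelCat.heq {X P : SymOperad.{u}} {φ : X ⟶ P} {n : ℕ} {a b c d : KernelCat φ n}
    (h : @Eq (X.op n) a c) (h' : @Eq (X.op n) b d) (f : a ⟶ b) (g : c ⟶ d) : HEq f g :=
  heq_of_thin (C := KernelCat φ n) h h' f g

/-- The symmetric **Cat**-operad with the objects of `X` and a unique arrow from `x` to `y`
whenever `φ x = φ y`. -/
def kernelOperad {X P : SymOperad.{u}} (φ : X ⟶ P) : CatOperad.{u, u} where
  op n := KernelCat φ n
  one := X.one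
  comp {n m k} hm :=
    { obj := fun x => X.comp hm x.1 x.2
      map := fun {x y} α => KernelCat.homMk (by
        have h : ∀ i, φ.map (n := k i) (x.2 i) = φ.map (n := k i) (y.2 i) :=
          fun i => KernelCat.eq_of_hom (α.2 i)
        have h' : φ.map (n := n) x.1 = φ.map (n := n) y.1 := KernelCat.eq_of_hom α.1
        exact (φ.map_comp hm x.1 x.2).trans <|
          (congrArg₂ (P.comp hm) h' (funext h)).trans (φ.map_comp hm y.1 y.2).symm)
      map_id := fun _ => thin_elim _ _
      map_comp := fun _ _ => thin_elim _ _ }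
  act {n} σ :=
    { obj := fun x => X.act σ x
      map := fun {x y} α => KernelCat.homMk <| (φ.map_act σ x).trans <|
        (congrArg (P.act σ) (KernelCat.eq_of_hom α)).trans (φ.map_act σ y).symm
      map_id := fun _ => thin_elim _ _
      map_comp := fun _ _ => thin_elim _ _ }
  assoc_obj hp _ _ hs hm hm' f g h := X.assoc hp hs hm hm' f g h
  assoc_map hp _ _ hs hm hm' f f' g g' h h' _ _ _ := KernelCat.heq
    (X.assoc hp hs hm hm' f g h) (X.assoc hp hs hm hm' f' g' h') _ _
  one_comp_obj hm f := X.one_comp hm f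
  one_comp_map hm f f' _ := KernelCat.heq (X.one_comp hm f) (X.one_comp hm f') _ _
  comp_one_obj hm f := X.comp_one hm f
  comp_one_map hm f f' _ := KernelCat.heq (X.comp_one hm f) (X.comp_one hm f') _ _
  act_one := Functor.hext (fun f => X.act_one f) fun f f' _ =>
    KernelCat.heq (X.act_one f) (X.act_one f') _ _
  act_mul σ τ := Functor.hext (fun f => X.act_mul σ τ f) fun f f' _ =>
    KernelCat.heq (X.act_mul σ τ f) (X.act_mul σ τ f') _ _
  act_comp_obj σ hm hm' f g := X.act_comp σ hm hm' f g
  act_comp_map σ hm hm' f f' g g' _ _ := KernelCat.heq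
    (X.act_comp σ hm hm' f g) (X.act_comp σ hm hm' f' g') _ _
  comp_act_obj τ hm f g := X.comp_act τ hm f g
  comp_act_map τ hm f f' g g' _ _ := KernelCat.heq
    (X.comp_act τ hm f g) (X.comp_act τ hm f' g') _ _

instance {X P : SymOperad.{u}} (φ : X ⟶ P) (n : ℕ) : Quiver.IsThin ((kernelOperad φ).op n) :=
  inferInstanceAs (Quiver.IsThin (KernelCat φ n))

/-- The explicit categorification of `P` with respect to `S`: its objects are the elements of the
free symmetric operad on `Φ`, with a unique arrow between two of them whenever they have the same
image in `P`. -/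
noncomputable def categorification {P : SymOperad.{u}} (S : Signature P) : Categorification S where
  Q := kernelOperad S.φ
  b :=
    { map := fun n =>
        { obj := fun x => x.as
          map := fun α => KernelCat.homMk (congrArg S.φ.map (Discrete.eq_of_hom α))
          map_id := fun _ => thin_elim _ _
          map_comp := fun _ _ => thin_elim _ _ }
      map_one := rfl
      map_comp := fun _ => Functor.hext (fun _ => rfl) fun _ _ _ => heq_of_thin rfl rfl _ _
      map_act := fun _ => Functor.hext (fun _ => rfl) fun _ _ _ => heq_of_thin rfl rfl _ _ }
  f :=
    { map := fun n => inducedFunctor _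
      map_one := congrArg Discrete.mk S.φ.map_one
      map_comp := fun hm => Functor.hext
        (fun x => congrArg Discrete.mk (S.φ.map_comp hm x.1 x.2))
        fun x y _ => heq_of_thin (congrArg Discrete.mk (S.φ.map_comp hm x.1 x.2))
          (congrArg Discrete.mk (S.φ.map_comp hm y.1 y.2)) _ _
      map_act := fun σ => Functor.hext (fun x => congrArg Discrete.mk (S.φ.map_act σ x))
        fun x y _ => heq_of_thin (congrArg Discrete.mk (S.φ.map_act σ x))
          (congrArg Discrete.mk (S.φ.map_act σ y)) _ _ }
  fac _ := Functor.hext (fun _ => rfl) fun _ _ _ => heq_of_thin rfl rfl _ _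
  bijective _ := ⟨fun _ _ h => Discrete.ext h, fun x => ⟨⟨x⟩, rfl⟩⟩
  full _ := InducedCategory.full _
  faithful _ := InducedCategory.faithful _

/-- The unbiased categorification `Wk(P)` of `P`. -/
noncomputable def Wk (P : SymOperad.{u}) : CatOperad.{u, u} :=
  (categorification (unbiasedSignature P)).Q

end SymOperad

namespace CatOperad

/-! ### Endomorphism operads, algebras and weak morphisms -/

theorem natTrans_heq {C : Type u₁} [Category.{v₁} C] {D : Type u₂} [Category.{v₂} D]
    {F G F' G' : C ⥤ D} (hF : F = F') (hG : G = G') {α : F ⟶ G} {β : F' ⟶ G'}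
    (h : ∀ X, HEq (α.app X) (β.app X)) : HEq α β := by
  subst hF hG
  exact heq_of_eq (NatTrans.ext (funext fun X => eq_of_heq (h X)))

section End

variable {A : Type w} [Category.{v} A]

/-- The `i`-th block of an `m`-tuple, for a decomposition of `m` into blocks of sizes `k i`. -/
abbrev block {B : Type u} {n m : ℕ} {k : Fin n → ℕ} (hm : ∑ i, k i = m) (a : Fin m → B) (i : Fin n) :
    Fin (k i) → B :=
  fun j => a (blockEquiv hm ⟨i, j⟩)

/-- The composite functor `a ↦ f (g₀ (a₀), …, g₍ₙ₋₁₎ (a₍ₙ₋₁₎))`, where `aᵢ` is the `i`-th block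
of `a`. -/
def endCompObj {n m : ℕ} {k : Fin n → ℕ} (hm : ∑ i, k i = m) (f : (Fin n → A) ⥤ A)
    (g : ∀ i, (Fin (k i) → A) ⥤ A) : (Fin m → A) ⥤ A where
  obj a := f.obj fun i => (g i).obj (block hm a i)
  map {a b} α := f.map (X := fun i => (g i).obj (block hm a i))
    (Y := fun i => (g i).obj (block hm b i))
    fun i => (g i).map (X := block hm a i) (Y := block hm b i) fun j => α (blockEquiv hm ⟨i, j⟩)
  map_id a := by
    have : ∀ i, (g i).map (X := block hm a i) (Y := block hm a i)
        (fun j => (𝟙 a : a ⟶ a) (blockEquiv hm ⟨i, j⟩)) = 𝟙 _ := fun i => (g i).map_id _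
    simp only [this]
    exact f.map_id _
  map_comp {a b c} α β := by
    rw [← f.map_comp]
    congr 1
    funext i
    exact (g i).map_comp (X := block hm a i) (Y := block hm b i) (Z := block hm c i)
      (fun j => α (blockEquiv hm ⟨i, j⟩)) (fun j => β (blockEquiv hm ⟨i, j⟩))

theorem block_assoc {B : Type u} {n p m : ℕ} {k : Fin n → ℕ} (hp : ∑ i, k i = p) {l : Fin p → ℕ}
    {s : Fin n → ℕ} (hs : ∀ i, ∑ j, l (blockEquiv hp ⟨i, j⟩) = s i) (hm : ∑ i, s i = m)
    (hm' : ∑ r, l r = m) (a : Fin m → B) :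
    (fun i j => block (hs i) (block hm a i) j) =
      fun i (j : Fin (k i)) => block hm' a (blockEquiv hp ⟨i, j⟩) := by
  funext i j t
  exact congrArg a (blockEquiv_assoc hp hs hm hm' i j t)

theorem endCompObj_assoc {n p m : ℕ} {k : Fin n → ℕ} (hp : ∑ i, k i = p) {l : Fin p → ℕ}
    {s : Fin n → ℕ} (hs : ∀ i, ∑ j, l (blockEquiv hp ⟨i, j⟩) = s i) (hm : ∑ i, s i = m)
    (hm' : ∑ r, l r = m) (f : (Fin n → A) ⥤ A) (g : ∀ i, (Fin (k i) → A) ⥤ A)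
    (h : ∀ r, (Fin (l r) → A) ⥤ A) :
    endCompObj hm f (fun i => endCompObj (hs i) (g i) fun j => h (blockEquiv hp ⟨i, j⟩)) =
      endCompObj hm' (endCompObj hp f g) h := by
  have hr : (fun i j t => blockEquiv hm ⟨i, blockEquiv (hs i) ⟨j, t⟩⟩) =
      fun i (j : Fin (k i)) t => blockEquiv hm' ⟨blockEquiv hp ⟨i, j⟩, t⟩ := by
    funext i j t
    exact blockEquiv_assoc hp hs hm hm' i j t
  let G (r : ∀ i (j : Fin (k i)), Fin (l (blockEquiv hp ⟨i, j⟩)) → Fin m) : (Fin m → A) ⥤ A :=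
    Functor.pi' (fun i => Functor.pi' (fun j => Pi.comap (fun _ => A) (r i j) ⋙
      h (blockEquiv hp ⟨i, j⟩)) ⋙ g i) ⋙ f
  exact congrArg G hr

theorem endCompObj_one_comp {n : ℕ} (hm : ∑ _i : Fin 1, n = n) (f : (Fin n → A) ⥤ A) :
    endCompObj hm (Pi.eval (fun _ : Fin 1 => A) 0) (fun _ => f) = f := by
  have hr : (fun j => blockEquiv (k := fun _ => n) hm ⟨0, j⟩) = id := by
    funext j
    exact blockEquiv_one_left hm 0 j
  exact congrArg (fun r : Fin n → Fin n => Pi.comap (fun _ => A) r ⋙ f) hr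

theorem endCompObj_comp_one {n : ℕ} (hm : ∑ _i : Fin n, 1 = n) (f : (Fin n → A) ⥤ A) :
    endCompObj hm f (fun _ => Pi.eval (fun _ : Fin 1 => A) 0) = f := by
  have hr : (fun i => blockEquiv (k := fun _ => 1) hm ⟨i, 0⟩) = id := by
    funext i
    exact blockEquiv_one_right hm i 0
  exact congrArg (fun r : Fin n → Fin n => Pi.comap (fun _ => A) r ⋙ f) hr

theorem endCompObj_act_comp {n m : ℕ} {k : Fin n → ℕ} (σ : Equiv.Perm (Fin n))
    (hm : ∑ i, k i = m) (hm' : ∑ i, k (σ i) = m) (f : (Fin n → A) ⥤ A)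
    (g : ∀ i, (Fin (k i) → A) ⥤ A) :
    endCompObj hm (Pi.comap (fun _ => A) σ ⋙ f) g =
      Pi.comap (fun _ => A) (blockPerm σ hm hm') ⋙ endCompObj hm' f fun i => g (σ i) := by
  have hr : (fun i j => blockEquiv hm ⟨σ i, j⟩) = fun i (j : Fin (k (σ i))) =>
      blockPerm σ hm hm' (blockEquiv (k := fun i => k (σ i)) hm' ⟨i, j⟩) := by
    funext i j
    exact (blockPerm_apply σ hm hm' i j).symm
  let G (r : ∀ i, Fin (k (σ i)) → Fin m) : (Fin m → A) ⥤ A :=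
    Functor.pi' (fun i => Pi.comap (fun _ => A) (r i) ⋙ g (σ i)) ⋙ f
  exact congrArg G hr

theorem endCompObj_comp_act {n m : ℕ} {k : Fin n → ℕ} (τ : ∀ i, Equiv.Perm (Fin (k i)))
    (hm : ∑ i, k i = m) (f : (Fin n → A) ⥤ A) (g : ∀ i, (Fin (k i) → A) ⥤ A) :
    endCompObj hm f (fun i => Pi.comap (fun _ => A) (τ i) ⋙ g i) =
      Pi.comap (fun _ => A) (blockSum τ hm) ⋙ endCompObj hm f g := by
  have hr : (fun i j => blockEquiv hm ⟨i, τ i j⟩) = fun i (j : Fin (k i)) =>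
      blockSum τ hm (blockEquiv hm ⟨i, j⟩) := by
    funext i j
    exact (blockSum_apply τ hm i j).symm
  let G (r : ∀ i, Fin (k i) → Fin m) : (Fin m → A) ⥤ A :=
    Functor.pi' (fun i => Pi.comap (fun _ => A) (r i) ⋙ g i) ⋙ f
  exact congrArg G hr

/-- The action of composition in the endomorphism operad on natural transformations. -/
def endCompMap {n m : ℕ} {k : Fin n → ℕ} (hm : ∑ i, k i = m) {f f' : (Fin n → A) ⥤ A}
    {g g' : ∀ i, (Fin (k i) → A) ⥤ A} (α : f ⟶ f') (β : ∀ i, g i ⟶ g' i) :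
    endCompObj hm f g ⟶ endCompObj hm f' g' where
  app a := α.app (fun i => (g i).obj (block hm a i)) ≫
    f'.map (X := fun i => (g i).obj (block hm a i)) (Y := fun i => (g' i).obj (block hm a i))
      fun i => (β i).app (block hm a i)
  naturality a b t := by
    simp only [endCompObj, Category.assoc, NatTrans.naturality_assoc, ← f'.map_comp]
    congr 2
    funext i
    exact (β i).naturality _

/-- The endomorphism operad of a category `A`, with `End(A) n` the category of functors
`Aⁿ ⥤ A`. The symmetric group acts by `(σ · f) (a) = f (a ∘ σ)`. -/
def endOperad (A : Type w) [Category.{v} A] : CatOperad.{max v w, max v w} where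
  op n := (Fin n → A) ⥤ A
  one := Pi.eval (fun _ : Fin 1 => A) 0
  comp hm :=
    { obj := fun x => endCompObj hm x.1 x.2
      map := fun α => endCompMap hm α.1 α.2
      map_id := fun x => by
        ext a
        exact (Category.id_comp _).trans (x.1.map_id _)
      map_comp := fun {x y z} α β => by
        ext a
        change (α.1.app _ ≫ β.1.app _) ≫ z.1.map
            ((fun i => (α.2 i).app (block hm a i) : (fun i => (x.2 i).obj (block hm a i)) ⟶
              fun i => (y.2 i).obj (block hm a i)) ≫
            (fun i => (β.2 i).app (block hm a i) : (fun i => (y.2 i).obj (block hm a i)) ⟶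
              fun i => (z.2 i).obj (block hm a i))) =
          (α.1.app _ ≫ y.1.map _) ≫ (β.1.app _ ≫ z.1.map _)
        rw [z.1.map_comp, Category.assoc, Category.assoc, NatTrans.naturality_assoc] }
  act σ := (Functor.whiskeringLeft _ _ A).obj (Pi.comap (fun _ => A) σ)
  assoc_obj := endCompObj_assoc
  assoc_map {n p m k} hp {l s} hs hm hm' {f f' g g' h h'} α β γ := by
    refine natTrans_heq (endCompObj_assoc hp hs hm hm' f g h)
      (endCompObj_assoc hp hs hm hm' f' g' h') fun a => ?_
    let X (b : ∀ i (j : Fin (k i)), Fin (l (blockEquiv hp ⟨i, j⟩)) → A) :=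
      α.app (fun i => (g i).obj fun j => (h (blockEquiv hp ⟨i, j⟩)).obj (b i j)) ≫
        f'.map (X := fun i => (g i).obj fun j => (h (blockEquiv hp ⟨i, j⟩)).obj (b i j))
          (Y := fun i => (g' i).obj fun j => (h' (blockEquiv hp ⟨i, j⟩)).obj (b i j))
          fun i => (β i).app _ ≫
            (g' i).map (X := fun j => (h (blockEquiv hp ⟨i, j⟩)).obj (b i j))
              (Y := fun j => (h' (blockEquiv hp ⟨i, j⟩)).obj (b i j))
              fun j => (γ (blockEquiv hp ⟨i, j⟩)).app (b i j)
    have e : HEq (X fun i j => block (hs i) (block hm a i) j)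
        (X fun i j => block hm' a (blockEquiv hp ⟨i, j⟩)) :=
      congr_arg_heq X (block_assoc hp hs hm hm' a)
    refine e.trans (heq_of_eq ?_)
    change α.app _ ≫ f'.map
        ((fun i => (β i).app (fun j => (h (blockEquiv hp ⟨i, j⟩)).obj
            (block hm' a (blockEquiv hp ⟨i, j⟩))) :
          (fun i => (g i).obj fun j => (h (blockEquiv hp ⟨i, j⟩)).obj
            (block hm' a (blockEquiv hp ⟨i, j⟩))) ⟶
          (fun i => (g' i).obj fun j => (h (blockEquiv hp ⟨i, j⟩)).obj
            (block hm' a (blockEquiv hp ⟨i, j⟩)))) ≫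
        (fun i => (g' i).map (X := fun j => (h (blockEquiv hp ⟨i, j⟩)).obj
              (block hm' a (blockEquiv hp ⟨i, j⟩)))
            (Y := fun j => (h' (blockEquiv hp ⟨i, j⟩)).obj
              (block hm' a (blockEquiv hp ⟨i, j⟩)))
            fun j => (γ (blockEquiv hp ⟨i, j⟩)).app (block hm' a (blockEquiv hp ⟨i, j⟩)))) =
      (α.app _ ≫ f'.map _) ≫ f'.map _
    rw [f'.map_comp, Category.assoc]
  one_comp_obj := endCompObj_one_comp
  one_comp_map {n} hm {f f'} α := by
    refine natTrans_heq (endCompObj_one_comp hm f) (endCompObj_one_comp hm f') fun a => ?_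
    have hr : block (k := fun _ => n) hm a 0 = a := by
      funext j
      exact congrArg a (blockEquiv_one_left hm 0 j)
    have e : HEq (α.app (block (k := fun _ => n) hm a 0)) (α.app a) := by rw [hr]
    exact (heq_of_eq (Category.id_comp _)).trans e
  comp_one_obj := endCompObj_comp_one
  comp_one_map {n} hm {f f'} α := by
    refine natTrans_heq (endCompObj_comp_one hm f) (endCompObj_comp_one hm f') fun a => ?_
    have hr : (fun i => block (k := fun _ => 1) hm a i 0) = a := by
      funext i
      exact congrArg a (blockEquiv_one_right hm i 0)
    have e : HEq (α.app (fun i => block (k := fun _ => 1) hm a i 0)) (α.app a) := by rw [hr]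
    refine HEq.trans (heq_of_eq ?_) e
    exact (congrArg (fun t => α.app _ ≫ t) (f'.map_id _)).trans (Category.comp_id _)
  act_one := rfl
  act_mul _ _ := rfl
  act_comp_obj := endCompObj_act_comp
  act_comp_map {n m k} σ hm hm' {f f' g g'} α β := by
    refine natTrans_heq (endCompObj_act_comp σ hm hm' f g)
      (endCompObj_act_comp σ hm hm' f' g') fun a => ?_
    let X (b : ∀ i, Fin (k (σ i)) → A) :=
      α.app (fun i => (g (σ i)).obj (b i)) ≫
        f'.map (X := fun i => (g (σ i)).obj (b i)) (Y := fun i => (g' (σ i)).obj (b i))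
          fun i => (β (σ i)).app (b i)
    have hr : (fun i => block hm a (σ i)) =
        fun i => block (k := fun i => k (σ i)) hm' (fun t => a (blockPerm σ hm hm' t)) i := by
      funext i j
      exact congrArg a (blockPerm_apply σ hm hm' i j).symm
    have e : HEq (X fun i => block hm a (σ i))
        (X fun i => block (k := fun i => k (σ i)) hm' (fun t => a (blockPerm σ hm hm' t)) i) :=
      congr_arg_heq X hr
    exact e
  comp_act_obj := endCompObj_comp_act
  comp_act_map {n m k} τ hm {f f' g g'} α β := by
    refine natTrans_heq (endCompObj_comp_act τ hm f g) (endCompObj_comp_act τ hm f' g') fun a => ?_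
    let X (b : ∀ i, Fin (k i) → A) :=
      α.app (fun i => (g i).obj (b i)) ≫
        f'.map (X := fun i => (g i).obj (b i)) (Y := fun i => (g' i).obj (b i))
          fun i => (β i).app (b i)
    have hr : (fun i j => block hm a i (τ i j)) =
        fun i => block hm (fun t => a (blockSum τ hm t)) i := by
      funext i j
      exact congrArg a (blockSum_apply τ hm i j).symm
    have e : HEq (X fun i j => block hm a i (τ i j))
        (X fun i => block hm (fun t => a (blockSum τ hm t)) i) :=
      congr_arg_heq X hr
    exact e

end End

set_option linter.checkUnivs false in
/-- An algebra for a symmetric **Cat**-operad `Q`: a category `A` with a morphism `Q → End(A)`. -/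
structure Algebra (Q : CatOperad.{v₁, u₁}) where
  carrier : Type w
  [cat : Category.{v} carrier]
  str : Hom Q (endOperad carrier)

attribute [instance] Algebra.cat

/-- The action `h n : Q n × Aⁿ ⥤ A` of an algebra. -/
def Algebra.h {Q : CatOperad.{v₁, u₁}} (A : Algebra.{v, w} Q) (n : ℕ) :
    (Q.op n × (Fin n → A.carrier)) ⥤ A.carrier :=
  Functor.uncurry.obj (A.str.map n : Q.op n ⥤ ((Fin n → A.carrier) ⥤ A.carrier))

theorem Algebra.h_comp_obj {Q : CatOperad.{v₁, u₁}} (A : Algebra.{v, w} Q) {n m : ℕ}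
    {k : Fin n → ℕ} (hm : ∑ i, k i = m) (p : Q.op n) (q : ∀ i, Q.op (k i))
    (a : Fin m → A.carrier) :
    (A.h m).obj ((Q.comp hm).obj (p, q), a) =
      (A.h n).obj (p, fun i => (A.h (k i)).obj (q i, block hm a i)) :=
  Functor.congr_obj (Functor.congr_obj (A.str.map_comp hm) (p, q)) a

theorem Algebra.h_one_obj {Q : CatOperad.{v₁, u₁}} (A : Algebra.{v, w} Q) (a : A.carrier) :
    (A.h 1).obj (Q.one, fun _ => a) = a :=
  Functor.congr_obj A.str.map_one fun _ => a

theorem Algebra.h_act_obj {Q : CatOperad.{v₁, u₁}} (A : Algebra.{v, w} Q) {n : ℕ}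
    (σ : Equiv.Perm (Fin n)) (p : Q.op n) (a : Fin n → A.carrier) :
    (A.h n).obj ((Q.act σ).obj p, a) = (A.h n).obj (p, fun i => a (σ i)) :=
  Functor.congr_obj (Functor.congr_obj (A.str.map_act σ) p) a

theorem map_heq {C : Type u₁} [Category.{v₁} C] {D : Type u₂} [Category.{v₂} D] (F : C ⥤ D)
    {a b a' b' : C} (ha : a = a') (hb : b = b') {f : a ⟶ b} {f' : a' ⟶ b'} (h : HEq f f') :
    HEq (F.map f) (F.map f') := by
  subst ha hb
  rw [eq_of_heq h]

/-- A functor `F : A ⥤ B` with natural transformations `ξ` (for each arity `n`) from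
`h'ₙ (p, F a₀, …, F a₍ₙ₋₁₎)` to `F (hₙ (p, a₀, …, a₍ₙ₋₁₎))`, functors of `(p, a)` in `Q n × Aⁿ`,
which are compatible with composition, units and the symmetric group actions. The `ξ` are not
required to be invertible here. -/
@[ext]
structure LaxMorphism {Q : CatOperad.{v₁, u₁}} (A B : Algebra.{v, w} Q) where
  F : A.carrier ⥤ B.carrier
  ξ : ∀ {n : ℕ} (p : Q.op n) (a : Fin n → A.carrier),
    (B.h n).obj (p, fun i => F.obj (a i)) ⟶ F.obj ((A.h n).obj (p, a))
  naturality : ∀ {n : ℕ} {p p' : Q.op n} {a a' : Fin n → A.carrier} (α : p ⟶ p')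
    (t : ∀ i, a i ⟶ a' i),
    (B.h n).map (Prod.mkHom α (Y₁ := fun i => F.obj (a i)) (Y₂ := fun i => F.obj (a' i))
        fun i => F.map (t i)) ≫ ξ p' a' =
      ξ p a ≫ F.map ((A.h n).map (Prod.mkHom α t))
  ξ_comp : ∀ {n m : ℕ} {k : Fin n → ℕ} (hm : ∑ i, k i = m) (p : Q.op n) (q : ∀ i, Q.op (k i))
    (a : Fin m → A.carrier),
    HEq (ξ ((Q.comp hm).obj (p, q)) a)
      ((B.h n).map (Prod.mkHom (𝟙 p)
          (Y₁ := fun i => (B.h (k i)).obj (q i, fun j => F.obj (block hm a i j)))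
          (Y₂ := fun i => F.obj ((A.h (k i)).obj (q i, block hm a i)))
          fun i => ξ (q i) (block hm a i)) ≫
        ξ p fun i => (A.h (k i)).obj (q i, block hm a i))
  ξ_one : ∀ a : A.carrier, HEq (ξ Q.one fun _ => a) (𝟙 (F.obj a))
  ξ_act : ∀ {n : ℕ} (σ : Equiv.Perm (Fin n)) (p : Q.op n) (a : Fin n → A.carrier),
    HEq (ξ ((Q.act σ).obj p) a) (ξ p fun i => a (σ i))

namespace LaxMorphism

variable {Q : CatOperad.{v₁, u₁}}

/-- The identity morphism of an algebra. -/
def id (A : Algebra.{v, w} Q) : LaxMorphism A A where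
  F := 𝟭 A.carrier
  ξ {n} p a := 𝟙 ((A.h n).obj (p, a))
  naturality α t := (Category.comp_id _).trans (Category.id_comp _).symm
  ξ_comp {n m k} hm p q a := by
    have e : (A.h n).map (𝟙 (p, fun i => (A.h (k i)).obj (q i, block hm a i))) = 𝟙 _ :=
      (A.h n).map_id _
    refine HEq.trans ?_ (heq_of_eq ((Category.comp_id _).trans e).symm)
    exact congr_arg_heq (fun x => 𝟙 x) (A.h_comp_obj hm p q a)
  ξ_one a := congr_arg_heq (fun x => 𝟙 x) (A.h_one_obj a)
  ξ_act σ p a := congr_arg_heq (fun x => 𝟙 x) (A.h_act_obj σ p a)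

/-- Composition of morphisms of algebras: `ξ` of the composite is
`h'' (p, G F a) ⟶ G (h' (p, F a)) ⟶ G (F (h (p, a)))`. -/
def comp {A B C : Algebra.{v, w} Q} (M : LaxMorphism A B) (N : LaxMorphism B C) :
    LaxMorphism A C where
  F := M.F ⋙ N.F
  ξ p a := N.ξ p (fun i => M.F.obj (a i)) ≫ N.F.map (M.ξ p a)
  naturality {n p p' a a'} α t := by
    have h1 := N.naturality α (a := fun i => M.F.obj (a i)) (a' := fun i => M.F.obj (a' i))
      fun i => M.F.map (t i)
    have h2 := congrArg N.F.map (M.naturality α t)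
    rw [N.F.map_comp, N.F.map_comp] at h2
    change (C.h n).map (Prod.mkHom α (Y₁ := fun i => N.F.obj (M.F.obj (a i)))
        (Y₂ := fun i => N.F.obj (M.F.obj (a' i))) fun i => N.F.map (M.F.map (t i))) ≫
        N.ξ p' (fun i => M.F.obj (a' i)) ≫ N.F.map (M.ξ p' a') =
      (N.ξ p (fun i => M.F.obj (a i)) ≫ N.F.map (M.ξ p a)) ≫
        N.F.map (M.F.map ((A.h n).map (Prod.mkHom α t)))
    rw [reassoc_of% h1, h2, Category.assoc]
  ξ_comp {n m k} hm p q a := by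
    have h1 := N.ξ_comp hm p q (fun t => M.F.obj (a t))
    have h2 := map_heq N.F (B.h_comp_obj hm p q (fun t => M.F.obj (a t)))
      (congrArg M.F.obj (A.h_comp_obj hm p q a)) (M.ξ_comp hm p q a)
    refine HEq.trans (heq_comp (C.h_comp_obj hm p q fun t => N.F.obj (M.F.obj (a t)))
      (congrArg N.F.obj (B.h_comp_obj hm p q fun t => M.F.obj (a t)))
      (congrArg N.F.obj (congrArg M.F.obj (A.h_comp_obj hm p q a))) h1 h2) (heq_of_eq ?_)
    have h3 := N.naturality (𝟙 p)
      (a := fun i => (B.h (k i)).obj (q i, fun j => M.F.obj (block hm a i j)))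
      (a' := fun i => M.F.obj ((A.h (k i)).obj (q i, block hm a i)))
      fun i => M.ξ (q i) (block hm a i)
    have h4 := (C.h n).map_comp
      (Prod.mkHom (𝟙 p)
        (Y₁ := fun i => (C.h (k i)).obj (q i, fun j => N.F.obj (M.F.obj (block hm a i j))))
        (Y₂ := fun i => N.F.obj ((B.h (k i)).obj (q i, fun j => M.F.obj (block hm a i j))))
        fun i => N.ξ (q i) (fun j => M.F.obj (block hm a i j)))
      (Prod.mkHom (𝟙 p)
        (Y₁ := fun i => N.F.obj ((B.h (k i)).obj (q i, fun j => M.F.obj (block hm a i j))))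
        (Y₂ := fun i => N.F.obj (M.F.obj ((A.h (k i)).obj (q i, block hm a i))))
        fun i => N.F.map (M.ξ (q i) (block hm a i)))
    rw [prod_comp, Category.comp_id] at h4
    refine Eq.trans ?_ (congrArg (fun t => t ≫ N.ξ p
      (fun i => M.F.obj ((A.h (k i)).obj (q i, block hm a i))) ≫
        N.F.map (M.ξ p fun i => (A.h (k i)).obj (q i, block hm a i))) h4).symm
    rw [N.F.map_comp, Category.assoc, Category.assoc, reassoc_of% h3]
  ξ_one a := by
    have h1 := N.ξ_one (M.F.obj a)
    have h2 := map_heq N.F (B.h_one_obj (M.F.obj a)) (congrArg M.F.obj (A.h_one_obj a)) (M.ξ_one a)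
    refine HEq.trans (heq_comp (C.h_one_obj (N.F.obj (M.F.obj a)))
      (congrArg N.F.obj (B.h_one_obj (M.F.obj a)))
      (congrArg N.F.obj (congrArg M.F.obj (A.h_one_obj a))) h1 h2) (heq_of_eq ?_)
    rw [N.F.map_id]
    exact Category.id_comp _
  ξ_act σ p a :=
    heq_comp (C.h_act_obj σ p _) (congrArg N.F.obj (B.h_act_obj σ p _))
      (congrArg N.F.obj (congrArg M.F.obj (A.h_act_obj σ p a)))
      (N.ξ_act σ p fun t => M.F.obj (a t))
      (map_heq N.F (B.h_act_obj σ p fun t => M.F.obj (a t))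
        (congrArg M.F.obj (A.h_act_obj σ p a)) (M.ξ_act σ p a))

theorem ext_of_F_eq {A B : Algebra.{v, w} Q} {M N : LaxMorphism A B} (hF : M.F = N.F)
    (hξ : ∀ {n : ℕ} (p : Q.op n) (a : Fin n → A.carrier), HEq (M.ξ p a) (N.ξ p a)) : M = N := by
  obtain ⟨F, ξ, _⟩ := M
  obtain ⟨G, ζ, _⟩ := N
  obtain rfl : F = G := hF
  congr
  funext n p a
  exact eq_of_heq (hξ p a)

end LaxMorphism

/-- The category of `Q`-algebras and lax morphisms. -/
instance {Q : CatOperad.{v₁, u₁}} : Category (Algebra.{v, w} Q) where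
  Hom := LaxMorphism
  id := LaxMorphism.id
  comp := LaxMorphism.comp
  id_comp M := LaxMorphism.ext_of_F_eq rfl fun p a => heq_of_eq <| by
    exact (congrArg (fun t => M.ξ p a ≫ t) (M.F.map_id _)).trans (Category.comp_id _)
  comp_id M := LaxMorphism.ext_of_F_eq rfl fun p a => heq_of_eq <| by
    exact Category.id_comp (M.ξ p a)
  assoc M N K := LaxMorphism.ext_of_F_eq rfl fun p a => heq_of_eq <| by
    change (K.ξ p _ ≫ K.F.map (N.ξ p _ ≫ N.F.map (M.ξ p a))) =
      (K.ξ p _ ≫ K.F.map (N.ξ p _)) ≫ K.F.map (N.F.map (M.ξ p a))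
    rw [K.F.map_comp, Category.assoc]

/-- The lax morphisms all of whose structure maps `ξ` are invertible. -/
def weakMorphisms (Q : CatOperad.{v₁, u₁}) : MorphismProperty (Algebra.{v, w} Q) :=
  fun _ _ M => ∀ (n : ℕ) (p : Q.op n) (a : Fin n → _), IsIso (LaxMorphism.ξ M p a)

instance (Q : CatOperad.{v₁, u₁}) : (weakMorphisms.{v, w} Q).IsMultiplicative where
  id_mem A n p a := inferInstanceAs (IsIso (𝟙 ((A.h n).obj (p, a))))
  comp_mem M N hM hN n p a := by
    have := hM n p a
    have := hN n p fun i => M.F.obj (a i)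
    exact inferInstanceAs (IsIso (LaxMorphism.ξ N p (fun i => M.F.obj (a i)) ≫
      N.F.map (LaxMorphism.ξ M p a)))

set_option linter.checkUnivs false in
/-- The category of `Q`-algebras and weak morphisms. -/
abbrev AlgWk (Q : CatOperad.{v₁, u₁}) := WideSubcategory (weakMorphisms.{v, w} Q)

end CatOperad

/-!
Two categorifications of `P`, even for different signatures, are weakly equivalent over `P`, and
restriction of algebras along such a weak equivalence is an equivalence of categories.

A signature `φ : F Φ ⟶ P` is levelwise surjective (`SymOperad.map_surjective_of_isRegularEpi`): `φ`
factors through its image, and the coequalizer property yields a section of the inclusion of the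
image. So, given categorifications `C` and `C'` for signatures `S` and `S'`, every generator of `S`
is sent to some object of `C'` representing the same operation of `P`. The objects of `C` form a
free operad, hence this choice extends to a morphism of operads on objects; since `C'` is full and
faithful over `P`, it extends uniquely to arrows (`Categorification.compare`).

The round trip `K : C.Q → C'.Q → C.Q` commutes with evaluation in `P`: `K x` and `x` represent the
same operation, so are uniquely isomorphic in the levelwise thin operad `C.Q`. For an algebra `A`,
these isomorphisms `K x ≅ x` act on the category underlying `A` and make the identity functor an
isomorphism from `A` to its restriction along `K`, natural in lax morphisms (`Hom.pullbackIso`);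
all coherence conditions hold because parallel arrows of `C.Q` are equal. Its components are
weak morphisms, and restriction preserves weak morphisms, so the same restriction functors give both
equivalences. The theorem is the case of the categorification for the signature `(U P, ε)`.
-/

/-! ### Signatures are levelwise surjective -/

namespace SymOperad

/-- The image of a morphism of symmetric operads, as a suboperad of the codomain. -/
def image {X P : SymOperad.{u}} (φ : X ⟶ P) : SymOperad.{u} where
  op n := Set.range (φ.map (n := n))
  one := ⟨P.one, X.one, φ.map_one⟩
  comp hm f g := ⟨P.comp hm f.1 fun i => (g i).1, X.comp hm f.2.choose fun i => (g i).2.choose, by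
    rw [φ.map_comp, f.2.choose_spec]
    simp only [(g _).2.choose_spec]⟩
  act σ f := ⟨P.act σ f.1, X.act σ f.2.choose, by rw [φ.map_act, f.2.choose_spec]⟩
  assoc hp _ _ hs hm hm' f g h :=
    Subtype.ext (P.assoc hp hs hm hm' f.1 (fun i => (g i).1) fun r => (h r).1)
  one_comp hm f := Subtype.ext (P.one_comp hm f.1)
  comp_one hm f := Subtype.ext (P.comp_one hm f.1)
  act_one f := Subtype.ext (P.act_one f.1)
  act_mul σ τ f := Subtype.ext (P.act_mul σ τ f.1)
  act_comp σ hm hm' f g := Subtype.ext (P.act_comp σ hm hm' f.1 fun i => (g i).1)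
  comp_act τ hm f g := Subtype.ext (P.comp_act τ hm f.1 fun i => (g i).1)

/-- The inclusion of the image. -/
def image.ι {X P : SymOperad.{u}} (φ : X ⟶ P) : image φ ⟶ P :=
  ⟨Subtype.val, rfl, fun _ _ _ => rfl, fun _ _ => rfl⟩

/-- The corestriction of a morphism to its image. -/
def image.lift {X P : SymOperad.{u}} (φ : X ⟶ P) : X ⟶ image φ where
  map x := ⟨φ.map x, x, rfl⟩
  map_one := Subtype.ext φ.map_one
  map_comp hm f g := Subtype.ext (φ.map_comp hm f g)
  map_act σ f := Subtype.ext (φ.map_act σ f)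

/-- If `φ` is the coequalizer of a pair, its corestriction to the image coequalizes that pair, and
the induced morphism from `P` to the image is a section of the inclusion. -/
theorem map_surjective_of_isRegularEpi {X P : SymOperad.{u}} {φ : X ⟶ P} (hφ : IsRegularEpi φ)
    (n : ℕ) : Function.Surjective (φ.map (n := n)) := by
  obtain ⟨⟨r⟩⟩ := hφ
  have hw : r.left ≫ image.lift φ = r.right ≫ image.lift φ := by
    ext n x
    exact Subtype.ext (congrArg (fun F : r.W ⟶ P => F.map x) r.w)
  obtain ⟨d, hd, -⟩ := Limits.Cofork.IsColimit.existsUnique r.isColimit (image.lift φ) hw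
  have h : d ≫ image.ι φ = 𝟙 P := Limits.Cofork.IsColimit.hom_ext r.isColimit <| by
    rw [reassoc_of% hd]
    exact (Category.comp_id φ).symm
  intro p
  have hp : (d.map p).1 = p := congrArg (fun F : P ⟶ P => F.map p) h
  exact hp ▸ (d.map p).2

end SymOperad

namespace CatOperad

variable {Q : CatOperad.{v₁, u₁}} {R : CatOperad.{v₂, u₂}} {T : CatOperad.{v₃, u₃}}

/-! ### Restriction of algebras along a morphism of operads -/

namespace Hom

/-- The identity morphism. -/
def id (Q : CatOperad.{v₁, u₁}) : Hom Q Q :=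
  ⟨fun n => 𝟭 (Q.op n), rfl, fun _ => rfl, fun _ => rfl⟩

/-- Composition of morphisms of symmetric **Cat**-operads. -/
def comp (K : Hom Q R) (L : Hom R T) : Hom Q T where
  map n := K.map n ⋙ L.map n
  map_one := (congrArg (L.map 1).obj K.map_one).trans L.map_one
  map_comp {n m k} hm :=
    (congrArg (· ⋙ L.map m) (K.map_comp hm)).trans
      (congrArg (((K.map n).prod (Functor.pi fun i => K.map (k i))) ⋙ ·) (L.map_comp hm))
  map_act {n} σ :=
    (congrArg (· ⋙ L.map n) (K.map_act σ)).trans (congrArg (K.map n ⋙ ·) (L.map_act σ))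

theorem map_comp_obj (K : Hom Q R) {n m : ℕ} {k : Fin n → ℕ} (hm : ∑ i, k i = m) (p : Q.op n)
    (q : ∀ i, Q.op (k i)) :
    (K.map m).obj ((Q.comp hm).obj (p, q)) =
      (R.comp hm).obj ((K.map n).obj p, fun i => (K.map (k i)).obj (q i)) :=
  Functor.congr_obj (K.map_comp hm) (p, q)

theorem map_act_obj (K : Hom Q R) {n : ℕ} (σ : Equiv.Perm (Fin n)) (p : Q.op n) :
    (K.map n).obj ((Q.act σ).obj p) = (R.act σ).obj ((K.map n).obj p) :=
  Functor.congr_obj (K.map_act σ) p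

/-- Restriction of algebras along a morphism of operads. -/
def pullback (K : Hom Q R) : Algebra.{v, w} R ⥤ Algebra.{v, w} Q where
  obj A := { carrier := A.carrier, str := K.comp A.str }
  map {A B} (M : LaxMorphism A B) :=
    { F := M.F
      ξ := fun p a => M.ξ ((K.map _).obj p) a
      naturality := fun α t => M.naturality ((K.map _).map α) t
      ξ_comp := fun {n m k} hm p q a => by
        refine (congr_arg_heq (fun x => M.ξ x a) (K.map_comp_obj hm p q)).trans ?_
        have h := M.ξ_comp hm ((K.map n).obj p) (fun i => (K.map (k i)).obj (q i)) a
        -- On the first factor, the target asks for `(K.map n).map (𝟙 p)`.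
        rw [← (K.map n).map_id p] at h
        exact h
      ξ_one := fun a =>
        (congr_arg_heq (fun x => M.ξ x fun _ => a) K.map_one).trans (M.ξ_one a)
      ξ_act := fun {n} σ p a =>
        (congr_arg_heq (fun x => M.ξ x a) (K.map_act_obj σ p)).trans
          (M.ξ_act σ ((K.map n).obj p) a) }
  map_id _ := rfl
  map_comp _ _ := rfl

theorem pullback_map_weak (K : Hom Q R) ⦃A B : Algebra.{v, w} R⦄ (M : A ⟶ B)
    (hM : weakMorphisms R M) : weakMorphisms Q (K.pullback.map M) :=
  fun n p a => hM n ((K.map n).obj p) a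

end Hom

/-! ### Invariance of restriction under isomorphism of morphisms of operads -/

theorem app_heq {C : Type u₁} [Category.{v₁} C] {D : Type u₂} [Category.{v₂} D]
    {E : Type u₃} [Category.{v₃} E] {F G : C ⥤ D ⥤ E} (h : F = G) {x y : C} (f : x ⟶ y) (a : D) :
    HEq ((F.map f).app a) ((G.map f).app a) := by
  subst h
  rfl

/-- The action of `A` on an arrow of `Q`, at a fixed tuple of objects. -/
def Algebra.hom (A : Algebra.{v, w} Q) {n : ℕ} {p p' : Q.op n} (α : p ⟶ p')
    (a : Fin n → A.carrier) : (A.h n).obj (p, a) ⟶ (A.h n).obj (p', a) :=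
  (A.h n).map (Prod.mkHom α (𝟙 a))

theorem Algebra.hom_eq_app (A : Algebra.{v, w} Q) {n : ℕ} {p p' : Q.op n} (α : p ⟶ p')
    (a : Fin n → A.carrier) :
    A.hom α a = NatTrans.app (C := Fin n → A.carrier) (D := A.carrier) ((A.str.map n).map α) a :=
  (congrArg (fun t => NatTrans.app (C := Fin n → A.carrier) (D := A.carrier)
    ((A.str.map n).map α) a ≫ t) (CategoryTheory.Functor.map_id (C := Fin n → A.carrier)
      (D := A.carrier) ((A.str.map n).obj p') a)).trans (Category.comp_id _)

theorem Algebra.hom_id (A : Algebra.{v, w} Q) {n : ℕ} (p : Q.op n) (a : Fin n → A.carrier) :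
    A.hom (𝟙 p) a = 𝟙 _ :=
  (A.h n).map_id (p, a)

theorem Algebra.hom_comp (A : Algebra.{v, w} Q) {n : ℕ} {p p' p'' : Q.op n} (α : p ⟶ p')
    (β : p' ⟶ p'') (a : Fin n → A.carrier) : A.hom (α ≫ β) a = A.hom α a ≫ A.hom β a := by
  refine Eq.trans ?_ ((A.h n).map_comp _ _)
  exact congrArg (fun t => (A.h n).map (Prod.mkHom (α ≫ β) t)) (Category.comp_id (𝟙 a)).symm

theorem Algebra.isIso_hom (A : Algebra.{v, w} Q) {n : ℕ} {p p' : Q.op n} (α : p ≅ p')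
    (a : Fin n → A.carrier) : IsIso (A.hom α.hom a) :=
  ⟨A.hom α.inv a, by rw [← A.hom_comp, α.hom_inv_id, A.hom_id],
    by rw [← A.hom_comp, α.inv_hom_id, A.hom_id]⟩

theorem Algebra.hom_heq (A : Algebra.{v, w} Q) {n : ℕ} {p p' q q' : Q.op n} (h : p = q)
    (h' : p' = q') {α : p ⟶ p'} {β : q ⟶ q'} (e : HEq α β) (a : Fin n → A.carrier) :
    HEq (A.hom α a) (A.hom β a) := by
  subst h h'
  rw [eq_of_heq e]

/-- The action is compatible with composition in `Q` on arrows, not only on objects. -/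
theorem Algebra.hom_comp_map (A : Algebra.{v, w} Q) {n m : ℕ} {k : Fin n → ℕ} (hm : ∑ i, k i = m)
    {p p' : Q.op n} {q q' : ∀ i, Q.op (k i)} (α : p ⟶ p') (β : ∀ i, q i ⟶ q' i)
    (a : Fin m → A.carrier) :
    HEq (A.hom ((Q.comp hm).map (Prod.mkHom α β)) a)
      ((A.h n).map (Prod.mkHom α (Y₁ := fun i => (A.h (k i)).obj (q i, block hm a i))
        (Y₂ := fun i => (A.h (k i)).obj (q' i, block hm a i))
        fun i => A.hom (β i) (block hm a i))) := by
  rw [A.hom_eq_app]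
  refine (app_heq (D := Fin m → A.carrier) (E := A.carrier) (A.str.map_comp hm) _ a).trans ?_
  simp only [A.hom_eq_app]
  rfl

theorem Algebra.hom_act_map (A : Algebra.{v, w} Q) {n : ℕ} (σ : Equiv.Perm (Fin n))
    {p p' : Q.op n} (α : p ⟶ p') (a : Fin n → A.carrier) :
    HEq (A.hom ((Q.act σ).map α) a) (A.hom α fun i => a (σ i)) := by
  rw [A.hom_eq_app, A.hom_eq_app]
  exact app_heq (D := Fin n → A.carrier) (E := A.carrier) (A.str.map_act σ) α a

namespace Hom

/-- Let `K K' : Q → R` be morphisms of operads and `R` levelwise thin. Arrows `K' p ⟶ K p` induce a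
lax morphism from the restriction along `K` of an algebra `A` to its restriction along `K'`, with
underlying functor the identity; the compatibilities hold since parallel arrows of `R` are equal.
The direction is reversed since `ξ` points from the operations of the codomain to those of the
domain. -/
def pullbackApp [∀ n, Quiver.IsThin (R.op n)] (K K' : Hom Q R)
    (α : ∀ (n : ℕ) (p : Q.op n), (K'.map n).obj p ⟶ (K.map n).obj p) (A : Algebra.{v, w} R) :
    LaxMorphism (K.pullback.obj A) (K'.pullback.obj A) where
  F := 𝟭 A.carrier
  ξ {n} p a := A.hom (α n p) a
  naturality {n p p' a a'} β t := by
    refine ((A.h n).map_comp (X := ((K'.map n).obj p, a)) (Y := ((K'.map n).obj p', a'))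
      (Z := ((K.map n).obj p', a')) (Prod.mkHom ((K'.map n).map β) t)
      (Prod.mkHom (α n p') (𝟙 a'))).symm.trans ?_
    refine Eq.trans ?_ ((A.h n).map_comp (X := ((K'.map n).obj p, a)) (Y := ((K.map n).obj p, a))
      (Z := ((K.map n).obj p', a')) (Prod.mkHom (α n p) (𝟙 a)) (Prod.mkHom ((K.map n).map β) t))
    congr 1
    exact Prod.ext (thin_elim _ _) (funext fun i =>
      (Category.comp_id (obj := A.carrier) (t i)).trans
        (Category.id_comp (obj := A.carrier) (t i)).symm)
  ξ_comp {n m k} hm p q a := by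
    refine (A.hom_heq (K'.map_comp_obj hm p q) (K.map_comp_obj hm p q)
      (heq_of_thin (K'.map_comp_obj hm p q) (K.map_comp_obj hm p q) (α m _)
        ((R.comp hm).map (Prod.mkHom (α n p) fun i => α (k i) (q i)))) a).trans ?_
    refine (A.hom_comp_map hm (α n p) (fun i => α (k i) (q i)) a).trans (heq_of_eq ?_)
    have h := (A.h n).map_comp
      (X := ((K'.map n).obj p, fun i => (A.h (k i)).obj ((K'.map (k i)).obj (q i), block hm a i)))
      (Y := ((K'.map n).obj p, fun i => (A.h (k i)).obj ((K.map (k i)).obj (q i), block hm a i)))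
      (Z := ((K.map n).obj p, fun i => (A.h (k i)).obj ((K.map (k i)).obj (q i), block hm a i)))
      (Prod.mkHom (𝟙 _) fun i => A.hom (α (k i) (q i)) (block hm a i))
      (Prod.mkHom (α n p) (𝟙 _))
    rw [prod_comp, Category.id_comp, Category.comp_id] at h
    have e : (K'.map n).map (𝟙 p) = 𝟙 _ := (K'.map n).map_id p
    refine h.trans ?_
    -- The structure map of the restriction along `K'` involves `(K'.map n).map (𝟙 p)`.
    rw [← e]
    rfl
  ξ_one a := by
    refine (A.hom_heq K'.map_one K.map_one
      (heq_of_thin K'.map_one K.map_one _ (𝟙 R.one)) fun _ => a).trans ?_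
    exact (heq_of_eq (A.hom_id R.one fun _ => a)).trans
      (congr_arg_heq (fun x => 𝟙 x) (A.h_one_obj a))
  ξ_act {n} σ p a :=
    (A.hom_heq (K'.map_act_obj σ p) (K.map_act_obj σ p)
      (heq_of_thin (K'.map_act_obj σ p) (K.map_act_obj σ p) (α n _)
        ((R.act σ).map (α n p))) a).trans (A.hom_act_map σ (α n p) a)

/-- Morphisms of operads into a levelwise thin operad which are objectwise isomorphic have
isomorphic restriction functors. -/
def pullbackIso [∀ n, Quiver.IsThin (R.op n)] (K K' : Hom Q R)
    (α : ∀ (n : ℕ) (p : Q.op n), (K'.map n).obj p ≅ (K.map n).obj p) :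
    K.pullback (R := R) ≅ (K'.pullback : Algebra.{v, w} R ⥤ Algebra.{v, w} Q) :=
  NatIso.ofComponents
    (fun A =>
      { hom := pullbackApp K K' (fun n p => (α n p).hom) A
        inv := pullbackApp K' K (fun n p => (α n p).inv) A
        hom_inv_id := LaxMorphism.ext_of_F_eq rfl fun {n} p a => heq_of_eq <| by
          refine (A.hom_comp _ _ a).symm.trans ?_
          rw [(α n p).inv_hom_id]
          exact A.hom_id _ a
        inv_hom_id := LaxMorphism.ext_of_F_eq rfl fun {n} p a => heq_of_eq <| by
          refine (A.hom_comp _ _ a).symm.trans ?_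
          rw [(α n p).hom_inv_id]
          exact A.hom_id _ a })
    fun {A B} (M : LaxMorphism A B) =>
      LaxMorphism.ext_of_F_eq rfl fun {n} p a => heq_of_eq <| by
        have h := M.naturality (α n p).hom (𝟙 a)
        have e : (fun i => M.F.map ((𝟙 a : a ⟶ a) i)) = 𝟙 (fun i => M.F.obj (a i)) :=
          funext fun i => M.F.map_id (a i)
        rw [e] at h
        exact h

theorem pullbackIso_hom_weak [∀ n, Quiver.IsThin (R.op n)] (K K' : Hom Q R)
    (α : ∀ (n : ℕ) (p : Q.op n), (K'.map n).obj p ≅ (K.map n).obj p) (A : Algebra.{v, w} R) :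
    weakMorphisms Q ((pullbackIso K K' α).hom.app A) :=
  fun n p a => A.isIso_hom (α n p) a

theorem pullbackIso_inv_weak [∀ n, Quiver.IsThin (R.op n)] (K K' : Hom Q R)
    (α : ∀ (n : ℕ) (p : Q.op n), (K'.map n).obj p ≅ (K.map n).obj p) (A : Algebra.{v, w} R) :
    weakMorphisms Q ((pullbackIso K K' α).inv.app A) :=
  fun n p a => A.isIso_hom (α n p).symm a

end Hom

end CatOperad

/-! ### Functors between wide subcategories -/

namespace CategoryTheory

/-- The functor between wide subcategories induced by a functor that maps `W` into `W'`. -/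
def Functor.mapWideSubcategory {C : Type u₁} [Category.{v₁} C] {D : Type u₂} [Category.{v₂} D]
    (F : C ⥤ D) (W : MorphismProperty C) [W.IsMultiplicative] (W' : MorphismProperty D)
    [W'.IsMultiplicative] (h : ∀ ⦃X Y : C⦄ (f : X ⟶ Y), W f → W' (F.map f)) :
    WideSubcategory W ⥤ WideSubcategory W' where
  obj X := ⟨F.obj X.obj⟩
  map f := ⟨F.map f.hom, h f.hom f.property⟩
  map_id _ := WideSubcategory.hom_ext _ (F.map_id _)
  map_comp _ _ := WideSubcategory.hom_ext _ (F.map_comp _ _)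

end CategoryTheory

namespace SymOperad

open CatOperad

/-! ### Comparison of categorifications -/

/-- The symmetric operad of objects of a symmetric **Cat**-operad. -/
def ofObjects (Q : CatOperad.{v, u}) : SymOperad.{u} where
  op := Q.op
  one := Q.one
  comp hm x y := (Q.comp hm).obj (x, y)
  act σ x := (Q.act σ).obj x
  assoc := Q.assoc_obj
  one_comp := Q.one_comp_obj
  comp_one := Q.comp_one_obj
  act_one f := Functor.congr_obj Q.act_one f
  act_mul σ τ f := Functor.congr_obj (Q.act_mul σ τ) f
  act_comp := Q.act_comp_obj
  comp_act := Q.comp_act_obj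

/-- The inverse of a levelwise bijective morphism of symmetric operads. -/
noncomputable def invOfBijective {X Y : SymOperad.{u}} (φ : X ⟶ Y)
    (h : ∀ n, Function.Bijective (φ.map (n := n))) : Y ⟶ X where
  map {n} := (Equiv.ofBijective _ (h n)).symm
  map_one := (Equiv.symm_apply_eq _).2 φ.map_one.symm
  map_comp hm _ _ := (Equiv.symm_apply_eq _).2 <| Eq.symm <| (φ.map_comp hm _ _).trans <|
    congrArg₂ (Y.comp hm) (Equiv.ofBijective_apply_symm_apply _ (h _) _)
      (funext fun _ => Equiv.ofBijective_apply_symm_apply _ (h _) _)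
  map_act σ f := (Equiv.symm_apply_eq _).2 <| Eq.symm <| (φ.map_act σ _).trans <|
    congrArg (Y.act σ) (Equiv.ofBijective_apply_symm_apply _ (h _) f)

theorem map_invOfBijective {X Y : SymOperad.{u}} (φ : X ⟶ Y)
    (h : ∀ n, Function.Bijective (φ.map (n := n))) {n : ℕ} (y : Y.op n) :
    φ.map ((invOfBijective φ h).map y) = y :=
  Equiv.ofBijective_apply_symm_apply _ (h n) y

namespace Categorification

variable {P : SymOperad.{u}} {S S' : Signature P}

instance (C : Categorification S) (n : ℕ) : Quiver.IsThin (C.Q.op n) := fun _ _ =>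
  have := C.faithful n
  ⟨fun _ _ => (C.f.map n).map_injective (thin_elim _ _)⟩

/-- The operation of `P` which an object of a categorification represents. -/
def val (C : Categorification S) {n : ℕ} (x : C.Q.op n) : P.op n :=
  ((C.f.map n).obj x).as

/-- The arrow between two objects representing the same operation. -/
noncomputable def homMk (C : Categorification S) {n : ℕ} {x y : C.Q.op n}
    (h : C.val x = C.val y) : x ⟶ y :=
  have := C.full n
  (C.f.map n).preimage (Discrete.eqToHom h)

/-- Objects representing the same operation are isomorphic. -/
noncomputable def isoMk (C : Categorification S) {n : ℕ} {x y : C.Q.op n}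
    (h : C.val x = C.val y) : x ≅ y :=
  ⟨C.homMk h, C.homMk h.symm, thin_elim _ _, thin_elim _ _⟩

theorem val_eq_of_hom (C : Categorification S) {n : ℕ} {x y : C.Q.op n} (α : x ⟶ y) :
    C.val x = C.val y :=
  Discrete.eq_of_hom ((C.f.map n).map α)

/-- The bijective morphism `b` on objects, which makes the objects of a categorification a free
symmetric operad on `Φ`. -/
def ofFree (C : Categorification S) : free S.Φ ⟶ ofObjects C.Q where
  map {n} x := (C.b.map n).obj ⟨x⟩
  map_one := C.b.map_one
  map_comp hm f g := C.b.map_comp_obj hm ⟨f⟩ fun i => ⟨g i⟩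
  map_act σ f := C.b.map_act_obj σ ⟨f⟩

theorem ofFree_bijective (C : Categorification S) (n : ℕ) :
    Function.Bijective (C.ofFree.map (n := n)) :=
  (C.bijective n).comp ⟨fun _ _ h => congrArg Discrete.as h, fun x => ⟨x.as, rfl⟩⟩

/-- Evaluation of objects in `P`, as a morphism of operads. -/
def valHom (C : Categorification S) : ofObjects C.Q ⟶ P where
  map x := C.val x
  map_one := congrArg Discrete.as C.f.map_one
  map_comp hm f g := congrArg Discrete.as (C.f.map_comp_obj hm f g)
  map_act σ f := congrArg Discrete.as (C.f.map_act_obj σ f)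

theorem val_ofFree (C : Categorification S) {n : ℕ} (x : (free S.Φ).op n) :
    C.val (C.ofFree.map x) = S.φ.map x :=
  congrArg Discrete.as (Functor.congr_obj (C.fac n) ⟨x⟩)

theorem val_surjective (C : Categorification S) {n : ℕ} : Function.Surjective (C.val (n := n)) :=
  fun p => by
    obtain ⟨x, hx⟩ := map_surjective_of_isRegularEpi S.regularEpi n p
    exact ⟨C.ofFree.map x, (C.val_ofFree x).trans hx⟩

/-- On objects, the comparison sends a generator `x` to a chosen object representing the same
operation of `P` as `x`; freeness extends this to all objects. -/
noncomputable def objHom (C : Categorification S) (C' : Categorification S') :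
    ofObjects C.Q ⟶ ofObjects C'.Q :=
  invOfBijective C.ofFree C.ofFree_bijective ≫
    free.lift fun _ x => (C'.val_surjective (S.φ.map (free.gen x))).choose

theorem val_objHom (C : Categorification S) (C' : Categorification S') {n : ℕ} (x : C.Q.op n) :
    C'.val ((C.objHom C').map x) = C.val x := by
  -- Both sides are morphisms out of a free operad, and agree on generators by the choice made.
  have h : free.lift (fun _ x => (C'.val_surjective (S.φ.map (free.gen x))).choose) ≫ C'.valHom =
      S.φ := free.hom_ext fun _ x => (C'.val_surjective (S.φ.map (free.gen x))).choose_spec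
  have h' := congrArg (fun F : free S.Φ ⟶ P =>
    F.map ((invOfBijective C.ofFree C.ofFree_bijective).map (n := n) x)) h
  refine h'.trans ((C.val_ofFree _).symm.trans ?_)
  exact congrArg C.val (map_invOfBijective C.ofFree C.ofFree_bijective x)

/-- The comparison morphism between two categorifications of `P`, for possibly different
signatures. -/
noncomputable def compare (C : Categorification S) (C' : Categorification S') :
    CatOperad.Hom C.Q C'.Q where
  map n :=
    { obj := fun x => (C.objHom C').map (n := n) x
      map := fun {x y} α => C'.homMk <|
        (C.val_objHom C' x).trans <| (C.val_eq_of_hom α).trans (C.val_objHom C' y).symm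
      map_id := fun _ => thin_elim _ _
      map_comp := fun _ _ => thin_elim _ _ }
  map_one := (C.objHom C').map_one
  map_comp {_ m _} hm := Functor.hext (fun x => (C.objHom C').map_comp hm x.1 x.2) fun x y _ =>
    heq_of_thin (C := C'.Q.op m) ((C.objHom C').map_comp hm x.1 x.2)
      ((C.objHom C').map_comp hm y.1 y.2) _ _
  map_act {n} σ := Functor.hext (fun x => (C.objHom C').map_act σ x) fun x y _ =>
    heq_of_thin (C := C'.Q.op n) ((C.objHom C').map_act σ x) ((C.objHom C').map_act σ y) _ _

theorem val_compare_obj (C : Categorification S) (C' : Categorification S') {n : ℕ}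
    (x : C.Q.op n) : C'.val (((C.compare C').map n).obj x) = C.val x :=
  C.val_objHom C' x

/-- An object is isomorphic to its image under the round trip through another categorification. -/
noncomputable def compareCompIso (C : Categorification S) (C' : Categorification S') (n : ℕ)
    (x : C.Q.op n) : (((C.compare C').comp (C'.compare C)).map n).obj x ≅ x :=
  C.isoMk ((C'.val_compare_obj C _).trans (C.val_compare_obj C' x))

/-- Restriction along the round trip is isomorphic to the identity. -/
noncomputable def unitIso (C : Categorification S) (C' : Categorification S') :
    𝟭 (Algebra.{v, w} C.Q) ≅ (C'.compare C).pullback ⋙ (C.compare C').pullback :=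
  Hom.pullbackIso (Hom.id C.Q) ((C.compare C').comp (C'.compare C)) (C.compareCompIso C')

/-- Algebras for two categorifications of `P` and lax morphisms form equivalent categories. -/
noncomputable def algebraEquivalence (C : Categorification S) (C' : Categorification S') :
    Algebra.{v, w} C.Q ≌ Algebra.{v, w} C'.Q :=
  .mk (C'.compare C).pullback (C.compare C').pullback (C.unitIso C') (C'.unitIso C).symm

theorem unitIso_hom_weak (C : Categorification S) (C' : Categorification S')
    (A : Algebra.{v, w} C.Q) : weakMorphisms C.Q ((C.unitIso C').hom.app A) :=
  Hom.pullbackIso_hom_weak (Hom.id C.Q) ((C.compare C').comp (C'.compare C)) (C.compareCompIso C') A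

theorem unitIso_inv_weak (C : Categorification S) (C' : Categorification S')
    (A : Algebra.{v, w} C.Q) : weakMorphisms C.Q ((C.unitIso C').inv.app A) :=
  Hom.pullbackIso_inv_weak (Hom.id C.Q) ((C.compare C').comp (C'.compare C)) (C.compareCompIso C') A

/-- Algebras for two categorifications of `P` and weak morphisms form equivalent categories. -/
noncomputable def algWkEquivalence (C : Categorification S) (C' : Categorification S') :
    AlgWk.{v, w} C.Q ≌ AlgWk.{v, w} C'.Q :=
  .mk ((C'.compare C).pullback.mapWideSubcategory _ _ (C'.compare C).pullback_map_weak)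
    ((C.compare C').pullback.mapWideSubcategory _ _ (C.compare C').pullback_map_weak)
    (NatIso.ofComponents
      (fun A => WideSubcategory.isoMk ((C.unitIso C').app A.obj)
        (C.unitIso_hom_weak C' A.obj) (C.unitIso_inv_weak C' A.obj))
      fun f => WideSubcategory.hom_ext _ ((C.unitIso C').hom.naturality f.hom))
    (NatIso.ofComponents
      (fun A => WideSubcategory.isoMk ((C'.unitIso C).symm.app A.obj)
        (C'.unitIso_inv_weak C A.obj) (C'.unitIso_hom_weak C A.obj))
      fun f => WideSubcategory.hom_ext _ ((C'.unitIso C).inv.naturality f.hom))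

end Categorification

end SymOperad

theorem mainTheorem2 {P : SymOperad.{u}} (S : SymOperad.Signature P)
    (C : SymOperad.Categorification S) :
    Nonempty (CatOperad.AlgWk.{v, w} C.Q ≌ CatOperad.AlgWk.{v, w} (SymOperad.Wk P)) ∧
      Nonempty (CatOperad.Algebra.{v, w} C.Q ≌ CatOperad.Algebra.{v, w} (SymOperad.Wk P)) :=
  ⟨⟨C.algWkEquivalence (SymOperad.categorification (SymOperad.unbiasedSignature P))⟩,
    ⟨C.algebraEquivalence (SymOperad.categorification (SymOperad.unbiasedSignature P))⟩⟩
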